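/- Work in four-dimensional Minkowski space, with free fields of the following types: real scalar, charged scalar, Dirac spinor, real vector (Gupta–Bleuler), each with a mass $m\ge 0$. Their components $A_1,\dots,A_{\mathrm p}$ are the basic generators, with canonical dimension $1$ for scalar and vector fields and $3/2$ for spinor fields; $\dim(\partial^\alpha A_i)=\dim(A_i)+|\alpha|$. Let $\mathcal F$ be the free unital graded-commutative algebra over $\mathbb C$ generated by the symbols $\partial^\alpha A_i$, $\alpha\in\mathbb N_0^4$. An element of $\mathcal F$ is homogeneous if it is a linear combination of monomials with the same fermion number, charge number and canonical dimension. A super-quadri-index $u$ is a finitely supported map from the generators to $\mathbb N_0$; $A^u$ is the corresponding monomial and $B^{(u)}$ the corresponding iterated graded derivative of $B\in\mathcal F$ with respect to the generators. Let $\mathrm T$ be a family of time-ordered products, i.e. multilinear maps $(B_1,\dots,B_n)\mapsto \mathrm T(B_1(x_1),\dots,B_n(x_n))$, $n\in\mathbb N_0$, from $\mathcal F^n$ to the operator-valued Schwartz distributions on the standard invariant dense domain of the Fock space (spanned by the vectors $\int f(x_1,\dots,x_n){:}A_{i_1}(x_1)\cdots A_{i_n}(x_n){:}\,\Omega$, $f\in\mathcal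 S(\mathbb R^{4n})$) that satisfy translational covariance, vanishing of vacuum expectation values of non-zero total fermion number, the Wick expansion, $\mathrm T(\emptyset)=1$, $\mathrm T(B(x))={:}B(x){:}$, $\mathrm T(B_1(x_1),\dots,B_n(x_n),1(x_{n+1}))=\mathrm T(B_1(x_1),\dots,B_n(x_n))$, graded symmetry, and causality. Let $\mathcal L_1,\dots,\mathcal L_{\mathrm q}\in\mathcal F$ be homogeneous interaction vertices with fermion number $0$ and canonical dimension $4$. **Theorem.** Suppose that all fields are massless and that $\mathrm T$ satisfies almost homogeneous scaling: for all $k\ge 1$ and all homogeneous polynomials $B_1,\dots,B_k$ of massless fields and their derivatives, the distribution $t=(\Omega|\mathrm T(B_1(x_1),\dots,B_k(x_k))\Omega)\in\mathcal S'(\mathbb R^{4k})$ scales almost homogeneously with degree $D=\sum_{j=1}^k\dim(B_j)$, that is, $\bigl(\sum_{i=1}^{4k} x_i\partial_{x_i}+D\bigr)^{P+1}t=0$ for some $P\in\mathbb N_0$ (the power of the scaling being the smallest such $P$). Then for all $k\ge 1$, all $l_1,\dots,l_k\in\{1,\dots,\mathrm q\}$ and all lists $(u_1,\dots,u_k)$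 of super-quadri-indices involving only massless fields, the Fourier transform (with kernel $e^{\mathrm i\sum_j q_j\cdot x_j}$, Minkowski products in the exponent) of $(\Omega|\mathrm T(\mathcal L_{l_1}^{(u_1)}(x_1),\dots,\mathcal L_{l_k}^{(u_k)}(x_k))\Omega)$ is of the form $$(2\pi)^4\,\delta(q_1+\dots+q_k)\,\tau(q_1,\dots,q_{k-1}),\qquad \tau\in\mathcal S'(\mathbb R^{4(k-1)}),$$ where $\tau$ has a zero of order $\omega:=4-\sum_{j=1}^k\dim(A^{u_j})$ at the origin in the sense of Łojasiewicz: with $N=4(k-1)$, for every multi-index $\gamma$ with $|\gamma|<\omega$ and every $g\in\mathcal S(\mathbb R^{N})$ with $\int \frac{d^Nq}{(2\pi)^N}\,g(q)=1$, $$\lim_{\epsilon\searrow0}\int\frac{d^Nq}{(2\pi)^N}\,\partial^\gamma\tau(q)\,\epsilon^{-N}g(q/\epsilon)=0 .$$ (If $\omega\le 0$ nothing is claimed about the zero.) -/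

import Mathlib

open MeasureTheory Filter Topology
open scoped SchwartzMap LineDeriv FourierTransform TensorProduct Nat

noncomputable section

namespace CPT

/-! ## Space-time and momentum space -/

/-- `ℝ^{4n}`: configurations `(x_1, …, x_n)` of `n` points of Minkowski space. -/
abbrev Config (n : ℕ) : Type := EuclideanSpace ℝ (Fin n × Fin 4)

/-- The `j`-th point of a configuration. -/
def pt {n : ℕ} (x : Config n) (j : Fin n) : Fin 4 → ℝ := fun μ => x (j, μ)

/-- The configuration all of whose points are equal to `a`. -/
def diag (n : ℕ) (a : Fin 4 → ℝ) : Config n := WithLp.toLp 2 fun jμ => a jμ.2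

/-- The diagonal entries of the Minkowski metric `diag(1,-1,-1,-1)`. -/
def metricSign (μ : Fin 4) : ℝ := if μ = 0 then 1 else -1

/-- The Minkowski inner product. -/
def mink (x y : Fin 4 → ℝ) : ℝ := ∑ μ, metricSign μ * x μ * y μ

/-- `x` lies in the causal past of `y`, i.e. in `y` plus the closed past light cone. -/
def InCausalPast (x y : Fin 4 → ℝ) : Prop := 0 ≤ mink (x - y) (x - y) ∧ x 0 ≤ y 0

/-- Spatial momenta. -/
abbrev Mom : Type := EuclideanSpace ℝ (Fin 3)

/-- The energy on the mass hyperboloid. -/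
def energy (m : ℝ) (p : Mom) : ℝ := Real.sqrt (m ^ 2 + ‖p‖ ^ 2)

/-- The contravariant components `p^μ` of the four-momentum on the mass hyperboloid. -/
def fourMom (m : ℝ) (p : Mom) : Fin 4 → ℝ := Fin.cons (energy m p) fun k => p k

/-- The density `1 / ((2π)^3 2 E)` with respect to `d^3p` of the invariant measure
`dμ_m(p) = (2π)^{-3} d^4p θ(p^0) δ(p^2 - m^2)` on the mass hyperboloid. -/
def shellDensity (m : ℝ) (p : Mom) : ℝ := ((2 * Real.pi) ^ 3 * (2 * energy m p))⁻¹

/-! ## Types of fields -/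

/-- The types of fields: real scalar, charged scalar, Dirac spinor and real vector fields. -/
inductive FieldKind where
  | realScalar
  | chargedScalar
  | dirac
  | realVector

/-- The components of a field. The boolean is `true` for the Hermitian conjugates `φ^*`, `ψ_a^*`. -/
def FieldKind.Component : FieldKind → Type
  | .realScalar => Unit
  | .chargedScalar => Bool
  | .dirac => Bool × Fin 4
  | .realVector => Fin 4

/-- The involution on the components of a field. -/
def FieldKind.conj : (K : FieldKind) → K.Component → K.Component
  | .realScalar => fun c => c
  | .chargedScalar => fun c => Bool.not c
  | .dirac => fun c => ((Bool.not c.1, c.2) : Bool × Fin 4)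
  | .realVector => fun c => c

/-- Canonical dimension. -/
def FieldKind.dim : FieldKind → ℚ
  | .realScalar => 1
  | .chargedScalar => 1
  | .dirac => 3 / 2
  | .realVector => 1

/-- Fermion number. -/
def FieldKind.fermion : (K : FieldKind) → K.Component → ℤ
  | .realScalar => fun _ => 0
  | .chargedScalar => fun _ => 0
  | .dirac => fun c : Bool × Fin 4 => if c.1 then -1 else 1
  | .realVector => fun _ => 0

/-- Charge number of a component, if the field (as opposed to its conjugate) has charge `e`. -/
def FieldKind.charge (e : ℤ) : (K : FieldKind) → K.Component → ℤ
  | .realScalar => fun _ => 0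
  | .chargedScalar => fun c : Bool => if c then -e else e
  | .dirac => fun c : Bool × Fin 4 => if c.1 then -e else e
  | .realVector => fun _ => 0

/-- The Dirac matrices `γ^μ` in the Dirac representation. -/
def gammaMatrix : Fin 4 → Matrix (Fin 4) (Fin 4) ℂ :=
  ![!![1, 0, 0, 0; 0, 1, 0, 0; 0, 0, -1, 0; 0, 0, 0, -1],
    !![0, 0, 0, 1; 0, 0, 1, 0; 0, -1, 0, 0; -1, 0, 0, 0],
    !![0, 0, 0, -Complex.I; 0, 0, Complex.I, 0; 0, Complex.I, 0, 0; -Complex.I, 0, 0, 0],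
    !![0, 0, 1, 0; 0, 0, 0, -1; -1, 0, 0, 0; 0, 1, 0, 0]]

/-- `γ^μ p_μ` for a four-momentum with contravariant components `p^μ`. -/
def slash (p : Fin 4 → ℝ) : Matrix (Fin 4) (Fin 4) ℂ :=
  ∑ μ, ((metricSign μ * p μ : ℝ) : ℂ) • gammaMatrix μ

/-- The polynomial `M_{cc'}(p)` in the Wightman two-point function
`(Ω|A_c(x) A_{c'}(y)Ω) = ∫ dμ_m(p) M_{cc'}(p) exp(-i p·(x-y))` of the free field: it is
`1` for scalar fields, `-g_{μν}` for vector fields (Gupta-Bleuler), `((p̸+m)γ^0)_{ab}` for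
`ψ_a, ψ_b^*` and `((p̸-m)γ^0)_{ba}` for `ψ_a^*, ψ_b`. -/
def FieldKind.twoPoint (m : ℝ) (p : Fin 4 → ℝ) : (K : FieldKind) → K.Component → K.Component → ℂ
  | .realScalar => fun _ _ => 1
  | .chargedScalar => fun c c' : Bool => if c = c' then 0 else 1
  | .dirac => fun c c' : Bool × Fin 4 =>
      match c.1, c'.1 with
      | false, true => ((slash p + (m : ℂ) • 1) * gammaMatrix 0) c.2 c'.2
      | true, false => ((slash p - (m : ℂ) • 1) * gammaMatrix 0) c'.2 c.2
      | _, _ => 0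
  | .realVector => fun c c' : Fin 4 => if c = c' then ((-metricSign c : ℝ) : ℂ) else 0

/-- The field content of a model: finitely many free fields with given types, masses and
charges. -/
structure FieldContent where
  num : ℕ
  kind : Fin num → FieldKind
  mass : Fin num → ℝ
  mass_nonneg : ∀ s, 0 ≤ mass s
  charge : Fin num → ℤ

namespace FieldContent

variable (M : FieldContent)

/-- The basic generators `A_1, …, A_p`. -/
abbrev Basic : Type := Σ s : Fin M.num, (M.kind s).Component

/-- The generators `∂^α A_i`. -/
structure Gen where
  field : M.Basic
  der : Fin 4 → ℕ

/-- A fixed linear ordering of the generators. -/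
instance : LinearOrder M.Gen :=
  letI : DecidableRel (WellOrderingRel : M.Gen → M.Gen → Prop) := Classical.decRel _
  linearOrderOfSTO WellOrderingRel

variable {M}

def Basic.conj (A : M.Basic) : M.Basic := ⟨A.1, (M.kind A.1).conj A.2⟩

def Basic.mass (A : M.Basic) : ℝ := M.mass A.1

def Basic.fermion (A : M.Basic) : ℤ := (M.kind A.1).fermion A.2

/-- The polynomial in the two-point function of two basic fields; distinct fields are
independent. -/
def Basic.twoPoint (A A' : M.Basic) (p : Mom) : ℂ :=
  if h : A.1 = A'.1 then
    (M.kind A'.1).twoPoint (M.mass A'.1) (fourMom (M.mass A'.1) p) (h ▸ A.2) A'.2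
  else 0

namespace Gen

def fermion (g : M.Gen) : ℤ := g.field.fermion

def charge (g : M.Gen) : ℤ := (M.kind g.field.1).charge (M.charge g.field.1) g.field.2

def dim (g : M.Gen) : ℚ := (M.kind g.field.1).dim + ∑ μ, (g.der μ : ℚ)

def Massless (g : M.Gen) : Prop := M.mass g.field.1 = 0

end Gen

variable (M)

/-! ## The algebra of symbolic fields -/

/-- Generators with even fermion number. -/
abbrev EvenGen : Type := {g : M.Gen // Even g.fermion}

/-- Generators with odd fermion number. -/
abbrev OddGen : Type := {g : M.Gen // ¬ Even g.fermion}

/-- The algebra of symbolic fields: the free unital graded-commutative algebra over `ℂ` on the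
generators, that is, the polynomial algebra on the even ones tensored with the exterior algebra
on the odd ones. -/
abbrev SymField : Type := MvPolynomial M.EvenGen ℂ ⊗[ℂ] ExteriorAlgebra ℂ (M.OddGen →₀ ℂ)

variable {M}

open Classical in
/-- A generator as an element of the algebra. -/
def Gen.toField (g : M.Gen) : M.SymField :=
  if h : Even g.fermion then MvPolynomial.X ⟨g, h⟩ ⊗ₜ[ℂ] 1
  else 1 ⊗ₜ[ℂ] ExteriorAlgebra.ι ℂ (Finsupp.single ⟨g, h⟩ 1)

open Classical in
/-- The graded derivation `∂/∂g` with respect to the generator `g` (acting from the left). -/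
def Gen.deriv (g : M.Gen) : M.SymField →ₗ[ℂ] M.SymField :=
  if h : Even g.fermion then
    TensorProduct.map (MvPolynomial.pderiv ⟨g, h⟩).toLinearMap LinearMap.id
  else
    TensorProduct.map LinearMap.id
      (CliffordAlgebra.contractLeft (Q := (0 : QuadraticForm ℂ (M.OddGen →₀ ℂ)))
        (Finsupp.lapply ⟨g, h⟩))

/-- The constant term of a symbolic field. -/
def constTerm : M.SymField →ₐ[ℂ] ℂ :=
  Algebra.TensorProduct.productMap (MvPolynomial.aeval fun _ => (0 : ℂ))
    ExteriorAlgebra.algebraMapInv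

variable (M) in
/-- Homogeneous polynomials with fermion number `f`, charge number `q` and dimension `d`: linear
combinations of monomials in the generators with these quantum numbers. -/
def homogeneous (f q : ℤ) (d : ℚ) : Submodule ℂ M.SymField :=
  Submodule.span ℂ {B | ∃ l : List M.Gen, (l.map Gen.fermion).sum = f ∧
    (l.map Gen.charge).sum = q ∧ (l.map Gen.dim).sum = d ∧ B = (l.map Gen.toField).prod}

variable (M) in
/-- Homogeneous polynomials in the massless fields and their derivatives. -/
def masslessHomogeneous (f q : ℤ) (d : ℚ) : Submodule ℂ M.SymField :=
  Submodule.span ℂ {B | ∃ l : List M.Gen, (∀ g ∈ l, g.Massless) ∧ (l.map Gen.fermion).sum = f ∧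
    (l.map Gen.charge).sum = q ∧ (l.map Gen.dim).sum = d ∧ B = (l.map Gen.toField).prod}

variable (M) in
/-- Super-quadri-indices. -/
abbrev Index : Type := M.Gen →₀ ℕ

namespace Index

/-- The ordered list of the generators in the monomial `A^r`. -/
def toList (r : M.Index) : List M.Gen := (Finsupp.toMultiset r).sort

/-- `r!` -/
def fact (r : M.Index) : ℕ := r.prod fun _ k => k !

def fermion (r : M.Index) : ℤ := r.sum fun g k => k * g.fermion

/-- `dim(A^r)` -/
def dim (r : M.Index) : ℚ := r.sum fun g k => k * g.dim

def OnlyMassless (r : M.Index) : Prop := ∀ g, r g ≠ 0 → g.Massless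

end Index

/-- `B^{(s)}`. The derivatives are taken in the order in which the generators appear in `A^s`, so
that `(A^s)^{(s)} = s!` whenever `A^s ≠ 0`. -/
def subPoly (B : M.SymField) (s : M.Index) : M.SymField := s.toList.foldl (fun C g => g.deriv C) B

/-! ## Fock space and Wick polynomials -/

variable (M) in
/-- Wave functions of Fock space vectors. The value of the wave function of `Ψ` at
`[(A_{i_1}, p_1), …, (A_{i_n}, p_n)]` is the improper inner product
`(A_{i_1}(p_1) ⋯ A_{i_n}(p_n) Ω | Ψ)`, where `A_i(p)` creates a quantum of momentum `p`. -/
abbrev Wave : Type := List (M.Basic × Mom) → ℂ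

variable (M) in
/-- The vacuum `Ω`. -/
def vacuumWave : M.Wave
  | [] => 1
  | _ :: _ => 0

/-- The annihilation part of the free field `∂^α A_i(x)`. -/
def annihilate (g : M.Gen) (x : Fin 4 → ℝ) (Ψ : M.Wave) : M.Wave := fun l =>
  ∫ p : Mom, (shellDensity g.field.mass p : ℂ) *
    (∏ μ, (-Complex.I * ((metricSign μ * fourMom g.field.mass p μ : ℝ) : ℂ)) ^ g.der μ) *
    Complex.exp (-Complex.I * (mink (fourMom g.field.mass p) x : ℂ)) *
    Ψ ((g.field.conj, p) :: l)

/-- The creation part of the free field `∂^α A_i(x)`. -/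
def create (g : M.Gen) (x : Fin 4 → ℝ) : M.Wave → M.Wave
  | _, [] => 0
  | Ψ, (A, p) :: l =>
      A.conj.twoPoint g.field p *
        (∏ μ, (Complex.I * ((metricSign μ * fourMom g.field.mass p μ : ℝ) : ℂ)) ^ g.der μ) *
        Complex.exp (Complex.I * (mink (fourMom g.field.mass p) x : ℂ)) * Ψ l +
      ((A.fermion * g.fermion).negOnePow : ℂ) * create g x (fun l' => Ψ ((A, p) :: l')) l

/-- The Wick product `:g_1(x_1) ⋯ g_m(x_m):` of generators. -/
def wickList : List (M.Gen × (Fin 4 → ℝ)) → M.Wave → M.Wave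
  | [], Ψ => Ψ
  | (g, x) :: l, Ψ =>
      create g x (wickList l Ψ) +
        ((g.fermion * (l.map fun h => h.1.fermion).sum).negOnePow : ℂ) •
          wickList l (annihilate g x Ψ)

/-- The Wick product `:A^{s_1}(x_1) ⋯ A^{s_n}(x_n):`. -/
def wickMonomials {n : ℕ} (s : Fin n → M.Index) (x : Config n) : M.Wave → M.Wave :=
  wickList (List.ofFn fun j => (s j).toList.map fun g => (g, pt x j)).flatten

/-- The Wick polynomial `:B(x):`, obtained from the expansion of `B` into the monomials `A^s`, whose
coefficients are the constant terms of `B^{(s)}` divided by `s!`. -/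
def wickPoly (B : M.SymField) (x : Config 1) (Ψ : M.Wave) : M.Wave := fun l =>
  ∑ᶠ s : M.Index, constTerm (subPoly B s) / (s.fact : ℂ) * wickMonomials (fun _ => s) x Ψ l

/-- The wave function of `∫ d^4x_1 ⋯ d^4x_n f(x_1,…,x_n) :A_{i_1}(x_1) ⋯ A_{i_n}(x_n): Ω`. -/
def smearedWave {n : ℕ} (i : Fin n → M.Basic) (f : 𝓢(Config n, ℂ)) : M.Wave := fun l =>
  ∫ x : Config n, f x * wickList (List.ofFn fun k => (⟨i k, 0⟩, pt x k)) (vacuumWave M) l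

variable (M) in
/-- The domain `𝓓_0`. -/
def domain : Submodule ℂ M.Wave :=
  Submodule.span ℂ {Ψ | ∃ (n : ℕ) (i : Fin n → M.Basic) (f : 𝓢(Config n, ℂ)), Ψ = smearedWave i f}

/-- The inner product of `∫ d^4x_1 ⋯ d^4x_n f(x_1,…,x_n) :A_{i_1}(x_1) ⋯ A_{i_n}(x_n): Ω`
with `Ψ`. -/
def bracket {n : ℕ} (i : Fin n → M.Basic) (f : 𝓢(Config n, ℂ)) (Ψ : M.Wave) : ℂ :=
  ∫ x : Config n, (starRingEnd ℂ) (f x) *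
    (List.ofFn fun k => ((⟨(i k).conj, 0⟩ : M.Gen), pt x k)).foldl
      (fun Φ gx => annihilate gx.1 gx.2 Φ) Ψ []

variable (M) in
/-- The unitary representation `U(a)` of translations. -/
def translate (a : Fin 4 → ℝ) : M.Wave →ₗ[ℂ] M.Wave where
  toFun Ψ := fun l =>
    Complex.exp (Complex.I * ((l.map fun Ap => mink (fourMom Ap.1.mass Ap.2) a).sum : ℂ)) * Ψ l
  map_add' Ψ Ψ' := by
    funext l
    exact mul_add _ _ _
  map_smul' c Ψ := by
    funext l
    exact mul_left_comm _ _ _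

/-- The constant function `1` on the one-point space `ℝ^0`. -/
def oneZero : 𝓢(Config 0, ℂ) :=
  HasCompactSupport.toSchwartzMap (f := fun _ : Config 0 => (1 : ℂ))
    (IsCompact.of_isClosed_subset (Set.toFinite _).isCompact (isClosed_tsupport _)
      (Set.subset_univ _))
    contDiff_const

theorem oneZero_apply (x : Config 0) : oneZero x = 1 := rfl

theorem integral_config_zero (F : Config 0 → ℂ) : ∫ x, F x = F 0 := by
  rw [volume_euclideanSpace_eq_dirac, integral_dirac]

theorem vacuumWave_mem : vacuumWave M ∈ M.domain := by
  refine Submodule.subset_span ⟨0, Fin.elim0, oneZero, ?_⟩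
  funext l
  rw [smearedWave, integral_config_zero]
  simp [wickList, oneZero_apply]

variable (M) in
/-- The vacuum as a vector of the domain. -/
def vacuum : M.domain := ⟨vacuumWave M, vacuumWave_mem⟩

theorem create_zero (g : M.Gen) (x : Fin 4 → ℝ) (l : List (M.Basic × Mom)) :
    create g x 0 l = 0 := by
  induction l with
  | nil => simp [create]
  | cons a l ih =>
    have h : (fun l' => (0 : M.Wave) (a :: l')) = 0 := rfl
    obtain ⟨A, p⟩ := a
    rw [create, h, ih]
    simp

theorem wickList_zero (l : List (M.Gen × (Fin 4 → ℝ))) : wickList l (0 : M.Wave) = 0 := by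
  induction l with
  | nil => rfl
  | cons a l ih =>
    obtain ⟨g, x⟩ := a
    have h : annihilate g x (0 : M.Wave) = 0 := by
      funext l
      simp [annihilate]
    rw [wickList, h, ih, smul_zero, add_zero]
    funext l
    exact create_zero g x l

theorem annihilate_vacuum (g : M.Gen) (x : Fin 4 → ℝ) : annihilate g x (vacuumWave M) = 0 := by
  funext l
  simp [annihilate, vacuumWave]

theorem create_smul (g : M.Gen) (x : Fin 4 → ℝ) (c : ℂ) (Ψ : M.Wave) (l : List (M.Basic × Mom)) :
    create g x (fun l' => c * Ψ l') l = c * create g x Ψ l := by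
  induction l generalizing Ψ with
  | nil => simp [create]
  | cons a l ih =>
    obtain ⟨A, p⟩ := a
    rw [create, create, ih]
    ring

theorem mink_add (p x a : Fin 4 → ℝ) : mink p (x + a) = mink p x + mink p a := by
  simp only [mink, Pi.add_apply, mul_add, Finset.sum_add_distrib]

theorem twoPoint_eq_zero {A A' : M.Basic} (h : A.1 ≠ A'.1) (p : Mom) : A.twoPoint A' p = 0 := by
  simp [Basic.twoPoint, h]

theorem create_translate (g : M.Gen) (x a : Fin 4 → ℝ) (Ψ : M.Wave) (l : List (M.Basic × Mom)) :
    create g (x + a) (translate M a Ψ) l = translate M a (create g x Ψ) l := by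
  induction l generalizing Ψ with
  | nil => simp [create, translate]
  | cons b l ih =>
    obtain ⟨A, p⟩ := b
    have h1 : (fun l' => translate M a Ψ ((A, p) :: l')) = fun l' =>
        Complex.exp (Complex.I * (mink (fourMom A.mass p) a : ℂ)) *
          translate M a (fun l'' => Ψ ((A, p) :: l'')) l' := by
      funext l'
      simp only [translate, LinearMap.coe_mk, AddHom.coe_mk, List.map_cons, List.sum_cons, mul_add,
        Complex.exp_add, mul_assoc, Complex.ofReal_add]
    rw [create, h1, create_smul, ih]
    simp only [translate, LinearMap.coe_mk, AddHom.coe_mk, List.map_cons, List.sum_cons, create,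
      mul_add, Complex.exp_add, Complex.ofReal_add, mink_add]
    by_cases hA : A.1 = g.field.1
    · have hm : g.field.mass = A.mass := by simp [Basic.mass, hA]
      rw [hm]
      ring
    · have h0 : A.conj.twoPoint g.field p = 0 := twoPoint_eq_zero (A := A.conj) hA p
      rw [h0]
      ring

theorem wickList_vacuum_translate (a : Fin 4 → ℝ) (L : List (M.Gen × (Fin 4 → ℝ))) :
    wickList (L.map fun h => (h.1, h.2 + a)) (vacuumWave M) =
      translate M a (wickList L (vacuumWave M)) := by
  induction L with
  | nil =>
    funext l
    cases l <;> simp [wickList, vacuumWave, translate]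
  | cons b L ih =>
    obtain ⟨g, x⟩ := b
    rw [List.map_cons, wickList, wickList, annihilate_vacuum, annihilate_vacuum, wickList_zero,
      wickList_zero, smul_zero, smul_zero, add_zero, add_zero, ih]
    funext l
    exact create_translate g x a _ l

theorem translate_smearedWave (a : Fin 4 → ℝ) {n : ℕ} (i : Fin n → M.Basic)
    (f : 𝓢(Config n, ℂ)) :
    translate M a (smearedWave i f) =
      smearedWave i (SchwartzMap.compSubConstCLM ℂ (diag n a) f) := by
  funext l
  have h : ∀ x : Config n, wickList (List.ofFn fun k => ((⟨i k, 0⟩ : M.Gen), pt (x + diag n a) k))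
      (vacuumWave M) l = translate M a (wickList (List.ofFn fun k => (⟨i k, 0⟩, pt x k))
        (vacuumWave M)) l := by
    intro x
    rw [← wickList_vacuum_translate, List.map_ofFn]
    rfl
  simp only [smearedWave]
  rw [← integral_add_right_eq_self _ (diag n a)]
  simp only [h, SchwartzMap.compSubConstCLM_apply, add_sub_cancel_right]
  simp only [translate, LinearMap.coe_mk, AddHom.coe_mk, smearedWave]
  rw [← integral_const_mul]
  refine integral_congr_ae (Eventually.of_forall fun x => ?_)
  simp only
  ring

theorem translate_mem (a : Fin 4 → ℝ) (Ψ : M.Wave) (h : Ψ ∈ M.domain) :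
    translate M a Ψ ∈ M.domain := by
  induction h using Submodule.span_induction with
  | mem Ψ h =>
    obtain ⟨n, i, f, rfl⟩ := h
    rw [translate_smearedWave]
    exact Submodule.subset_span ⟨n, i, _, rfl⟩
  | zero => simp
  | add _ _ _ _ h1 h2 => simpa using add_mem h1 h2
  | smul c _ _ h1 => simpa using Submodule.smul_mem _ c h1

variable (M) in
/-- The representation `U(a)` of translations on the domain. -/
def U (a : Fin 4 → ℝ) : M.domain →ₗ[ℂ] M.domain :=
  (translate M a).restrict (translate_mem a)

end FieldContent

/-! ## Operations on test functions and distributions -/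

/-- The first `m` points of a configuration of `m + n` points. -/
def leftPts {m n : ℕ} (x : Config (m + n)) : Config m :=
  WithLp.toLp 2 fun jμ => x (Fin.castAdd n jμ.1, jμ.2)

/-- The last `n` points of a configuration of `m + n` points. -/
def rightPts {m n : ℕ} (x : Config (m + n)) : Config n :=
  WithLp.toLp 2 fun jμ => x (Fin.natAdd m jμ.1, jμ.2)

/-- `g = g₁ ⊗ g₂`. -/
def IsTensor {m n : ℕ} (g : 𝓢(Config (m + n), ℂ)) (g₁ : 𝓢(Config m, ℂ)) (g₂ : 𝓢(Config n, ℂ)) :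
    Prop :=
  ∀ x, g x = g₁ (leftPts x) * g₂ (rightPts x)

/-- The test function `(x_1, …, x_n) ↦ g(y)`, where `y_{π(j)} = x_j`. -/
def permute {n : ℕ} (π : Equiv.Perm (Fin n)) : 𝓢(Config n, ℂ) →L[ℂ] 𝓢(Config n, ℂ) :=
  SchwartzMap.compCLMOfContinuousLinearEquiv ℂ
    (LinearIsometryEquiv.piLpCongrLeft 2 ℝ ℝ
      (Equiv.prodCongr π (Equiv.refl (Fin 4)))).toContinuousLinearEquiv

theorem permute_apply {n : ℕ} (π : Equiv.Perm (Fin n)) (g : 𝓢(Config n, ℂ)) (x : Config n) :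
    permute π g x = g (WithLp.toLp 2 fun jμ => x (π.symm jμ.1, jμ.2)) := rfl

/-- The sign `(-1)^{f(π)}` of a permutation of objects with fermion numbers `f`. -/
def gradedSign {n : ℕ} (f : Fin n → ℤ) (π : Equiv.Perm (Fin n)) : ℂ :=
  ∏ i, ∏ j, if i < j ∧ π j < π i then ((f (π i) * f (π j)).negOnePow : ℂ) else 1

/-- The sign in the Wick expansion of a product of homogeneous fields `B_1, …, B_n` with fermion
numbers `f`: it arises by moving, in the product of the `A^{s_j} B_j^{(s_j)}`, all `A^{s_j}` in
front of all `B_j^{(s_j)}`. -/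
def wickSign {M : FieldContent} {n : ℕ} (f : Fin n → ℤ) (s : Fin n → M.Index) : ℂ :=
  ∏ i, ∏ j, if i < j then (((f i + (s i).fermion) * (s j).fermion).negOnePow : ℂ) else 1

/-! ## Time-ordered products -/

open FieldContent

/-- A family of time-ordered products: multi-linear maps from symbolic fields to operator-valued
Schwartz distributions on `𝓓_0` subject to the axioms of causal perturbation theory. -/
structure TimeOrdered (M : FieldContent) where
  /-- `T n B g` is the operator `∫ g(x_1,…,x_n) T(B_1(x_1),…,B_n(x_n)) d^4x_1 ⋯ d^4x_n`. -/
  T : (n : ℕ) → MultilinearMap ℂ (fun _ : Fin n => M.SymField)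
    (𝓢(Config n, ℂ) →ₗ[ℂ] (M.domain →ₗ[ℂ] M.domain))
  /-- The matrix elements are Schwartz distributions. -/
  continuous_bracket : ∀ (n : ℕ) (B : Fin n → M.SymField) (m : ℕ) (i : Fin m → M.Basic)
    (f : 𝓢(Config m, ℂ)) (Ψ : M.domain), Continuous fun g => bracket i f (T n B g Ψ : M.Wave)
  /-- Translational covariance. -/
  covariance : ∀ (n : ℕ) (B : Fin n → M.SymField) (a : Fin 4 → ℝ) (g : 𝓢(Config n, ℂ)),
    U M a ∘ₗ T n B g = T n B (SchwartzMap.compSubConstCLM ℂ (diag n a) g) ∘ₗ U M a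
  /-- Vacuum expectation values with non-zero total fermion number vanish. -/
  fermion_zero : ∀ (n : ℕ) (B : Fin n → M.SymField) (f q : Fin n → ℤ) (d : Fin n → ℚ),
    (∀ j, B j ∈ homogeneous M (f j) (q j) (d j)) → ∑ j, f j ≠ 0 →
    ∀ g, (T n B g (vacuum M) : M.Wave) [] = 0
  /-- Wick expansion. For fixed `Ψ` and `l`, the smooth function
  `x ↦ (:A^{s_1}(x_1) ⋯ A^{s_n}(x_n): Ψ)(l)` multiplies the test function. -/
  wick_expansion : ∀ (n : ℕ) (B : Fin n → M.SymField) (f q : Fin n → ℤ) (d : Fin n → ℚ),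
    (∀ j, B j ∈ homogeneous M (f j) (q j) (d j)) →
    ∀ (g : 𝓢(Config n, ℂ)) (Ψ : M.domain) (l : List (M.Basic × Mom)),
      (T n B g Ψ : M.Wave) l = ∑ᶠ s : Fin n → M.Index,
        wickSign f s / (∏ j, ((s j).fact : ℂ)) *
          (T n (fun j => subPoly (B j) (s j))
            (SchwartzMap.smulLeftCLM ℂ (fun x => wickMonomials s x (Ψ : M.Wave) l) g)
            (vacuum M) : M.Wave) []
  /-- `T(∅) = 1` -/
  empty : ∀ (B : Fin 0 → M.SymField) (g : 𝓢(Config 0, ℂ)), T 0 B g = g 0 • LinearMap.id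
  /-- `T(B(x)) = :B(x):` -/
  single : ∀ (B : M.SymField) (g : 𝓢(Config 1, ℂ)) (Ψ : M.domain) (l : List (M.Basic × Mom)),
    (T 1 (fun _ => B) g Ψ : M.Wave) l = ∫ x : Config 1, g x * wickPoly B x (Ψ : M.Wave) l
  /-- `T(B_1(x_1),…,B_n(x_n),1(x_{n+1})) = T(B_1(x_1),…,B_n(x_n))` -/
  unit : ∀ (n : ℕ) (B : Fin n → M.SymField) (g : 𝓢(Config (n + 1), ℂ)) (g₁ : 𝓢(Config n, ℂ))
    (g₂ : 𝓢(Config 1, ℂ)), IsTensor g g₁ g₂ →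
    T (n + 1) (Fin.append B fun _ => 1) g = (∫ x, g₂ x) • T n B g₁
  /-- Graded symmetry. -/
  graded_symm : ∀ (n : ℕ) (B : Fin n → M.SymField) (f q : Fin n → ℤ) (d : Fin n → ℚ),
    (∀ j, B j ∈ homogeneous M (f j) (q j) (d j)) →
    ∀ (π : Equiv.Perm (Fin n)) (g : 𝓢(Config n, ℂ)),
      T n B g = gradedSign f π • T n (B ∘ π) (permute π g)
  /-- Causality. -/
  causality : ∀ (m n : ℕ) (B : Fin m → M.SymField) (C : Fin n → M.SymField)
    (g : 𝓢(Config (m + n), ℂ)) (g₁ : 𝓢(Config m, ℂ)) (g₂ : 𝓢(Config n, ℂ)), IsTensor g g₁ g₂ →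
    (∀ x ∈ tsupport g₁, ∀ y ∈ tsupport g₂, ∀ i j, ¬ InCausalPast (pt x i) (pt y j)) →
    T (m + n) (Fin.append B C) g = T m B g₁ ∘ₗ T n C g₂

namespace TimeOrdered

variable {M : FieldContent} (T : TimeOrdered M)

/-- The vacuum expectation value `(Ω|T(B_1(x_1),…,B_n(x_n))Ω)`. -/
def vev (n : ℕ) (B : Fin n → M.SymField) : 𝓢'(Config n, ℂ) :=
  ContinuousLinearMap.toPointwiseConvergenceCLM _ _ _ _
    { toFun := fun g => (T.T n B g (vacuum M) : M.Wave) []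
      map_add' := fun g g' => by simp
      map_smul' := fun c g => by simp
      cont := by
        have h := T.continuous_bracket n B 0 Fin.elim0 oneZero (vacuum M)
        simp only [bracket, integral_config_zero] at h
        simpa [oneZero_apply] using h }

theorem vev_apply (n : ℕ) (B : Fin n → M.SymField) (g : 𝓢(Config n, ℂ)) :
    T.vev n B g = (T.T n B g (vacuum M) : M.Wave) [] := rfl

end TimeOrdered

/-! ## Almost homogeneous scaling -/

/-- `(∑_j x_j ∂_j + D) t` -/
def eulerShift {ι : Type} [Fintype ι] [DecidableEq ι] (D : ℝ) (t : 𝓢'(EuclideanSpace ℝ ι, ℂ)) :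
    𝓢'(EuclideanSpace ℝ ι, ℂ) :=
  ∑ j, TemperedDistribution.smulLeftCLM ℂ (fun x : EuclideanSpace ℝ ι => (x j : ℂ))
    (∂_{EuclideanSpace.single j (1 : ℝ)} t) + (D : ℂ) • t

/-- `t` scales almost homogeneously with degree `D` and power `P`. -/
def ScalesAlmostHomogeneously {ι : Type} [Fintype ι] [DecidableEq ι]
    (t : 𝓢'(EuclideanSpace ℝ ι, ℂ)) (D : ℝ) (P : ℕ) : Prop :=
  (eulerShift D)^[P + 1] t = 0 ∧ ∀ P' < P, (eulerShift D)^[P' + 1] t ≠ 0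

/-- The normalization condition of almost homogeneous scaling. -/
def TimeOrdered.AlmostHomogeneousScaling {M : FieldContent} (T : TimeOrdered M) : Prop :=
  ∀ (k : ℕ), 1 ≤ k → ∀ (B : Fin k → M.SymField) (f q : Fin k → ℤ) (d : Fin k → ℚ),
    (∀ j, B j ∈ masslessHomogeneous M (f j) (q j) (d j)) →
    ∃ P, ScalesAlmostHomogeneously (T.vev k B) ((∑ j, d j : ℚ) : ℝ) P

/-! ## Zeros in the sense of Łojasiewicz -/

/-- `g_ε(q) = ε^{-N} g(q/ε)` for `ε > 0`. -/
def rescale {ι : Type} [Fintype ι] (ε : ℝ) (g : 𝓢(EuclideanSpace ℝ ι, ℂ)) :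
    𝓢(EuclideanSpace ℝ ι, ℂ) :=
  if h : ε = 0 then 0 else
    ((ε⁻¹ ^ Fintype.card ι : ℝ) : ℂ) • SchwartzMap.compCLMOfContinuousLinearEquiv ℂ
      (ContinuousLinearEquiv.smulLeft (Units.mk0 ε⁻¹ (inv_ne_zero h))) g

theorem rescale_apply {ι : Type} [Fintype ι] {ε : ℝ} (h : ε ≠ 0) (g : 𝓢(EuclideanSpace ℝ ι, ℂ))
    (q : EuclideanSpace ℝ ι) :
    rescale ε g q = ((ε⁻¹ ^ Fintype.card ι : ℝ) : ℂ) * g (ε⁻¹ • q) := by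
  simp only [rescale, dif_neg h]
  rfl

/-- `t` has the value `c` at zero in the sense of Łojasiewicz. -/
def HasValueAtZero {ι : Type} [Fintype ι] (t : 𝓢'(EuclideanSpace ℝ ι, ℂ)) (c : ℂ) : Prop :=
  ∀ g : 𝓢(EuclideanSpace ℝ ι, ℂ),
    (∫ q, g q) / (2 * Real.pi : ℂ) ^ Fintype.card ι = 1 →
    Tendsto (fun ε : ℝ => t (rescale ε g) / (2 * Real.pi : ℂ) ^ Fintype.card ι) (𝓝[>] 0) (𝓝 c)

/-- The partial derivative `∂^γ t` for a multi-index `γ`. -/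
def multiDeriv {ι : Type} [Fintype ι] [DecidableEq ι] (γ : ι → ℕ)
    (t : 𝓢'(EuclideanSpace ℝ ι, ℂ)) : 𝓢'(EuclideanSpace ℝ ι, ℂ) :=
  (Finset.univ : Finset ι).toList.foldr
    (fun j s => (fun r => ∂_{EuclideanSpace.single j (1 : ℝ)} r)^[γ j] s) t

/-- `t` has zero of order `ω` at the origin in the sense of Łojasiewicz (no condition if
`ω ≤ 0`). -/
def HasZeroOfOrder {ι : Type} [Fintype ι] [DecidableEq ι] (t : 𝓢'(EuclideanSpace ℝ ι, ℂ))
    (ω : ℚ) : Prop :=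
  ∀ γ : ι → ℕ, ((∑ j, γ j : ℕ) : ℚ) < ω → HasValueAtZero (multiDeriv γ t) 0

/-! ## Momentum space -/

/-- The map `q ↦ -(2π)⁻¹ η q`, where `η` flips the sign of the spatial components of each point. -/
def minkScale (n : ℕ) : Config n ≃L[ℝ] Config n :=
  (LinearIsometryEquiv.piLpCongrRight 2 fun jμ : Fin n × Fin 4 =>
    if jμ.2 = 0 then LinearIsometryEquiv.refl ℝ ℝ
    else LinearIsometryEquiv.neg ℝ).toContinuousLinearEquiv.trans
  (ContinuousLinearEquiv.smulLeft (Units.mk0 (-(2 * Real.pi)⁻¹)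
    (neg_ne_zero.mpr (inv_ne_zero Real.two_pi_pos.ne'))))

theorem minkScale_apply (n : ℕ) (x : Config n) (jμ : Fin n × Fin 4) :
    minkScale n x jμ = -(2 * Real.pi)⁻¹ * (metricSign jμ.2 * x jμ) := by
  obtain ⟨j, μ⟩ := jμ
  have : minkScale n x (j, μ) = -(2 * Real.pi)⁻¹ * ((if μ = 0 then LinearIsometryEquiv.refl ℝ ℝ
    else LinearIsometryEquiv.neg ℝ : ℝ ≃ₗᵢ[ℝ] ℝ) (x (j, μ))) := rfl
  rw [this, metricSign]
  split_ifs <;> simp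

/-- The Fourier transform of test functions with the Minkowski product in the exponent. -/
def fourierTest (n : ℕ) : 𝓢(Config n, ℂ) →L[ℂ] 𝓢(Config n, ℂ) :=
  SchwartzMap.compCLMOfContinuousLinearEquiv ℂ (minkScale n) ∘L FourierTransform.fourierCLM ℂ 𝓢(Config n, ℂ)

theorem fourierTest_apply (n : ℕ) (g : 𝓢(Config n, ℂ)) (x : Config n) :
    fourierTest n g x = ∫ q : Config n,
      Complex.exp (Complex.I * ((∑ j, mink (pt q j) (pt x j) : ℝ) : ℂ)) * g q := by
  have h : fourierTest n g x = 𝓕 (g : Config n → ℂ) (minkScale n x) := rfl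
  rw [h, Real.fourier_eq']
  refine integral_congr_ae (Eventually.of_forall fun q => ?_)
  have h2 : -2 * Real.pi * inner ℝ q (minkScale n x) = ∑ j, mink (pt q j) (pt x j) := by
    rw [PiLp.inner_apply, Fintype.sum_prod_type, Finset.mul_sum]
    refine Finset.sum_congr rfl fun j _ => ?_
    rw [mink, Finset.mul_sum]
    refine Finset.sum_congr rfl fun μ _ => ?_
    rw [minkScale_apply]
    simp only [pt, RCLike.inner_apply, conj_trivial]
    field_simp
  simp only [smul_eq_mul]
  rw [← h2, mul_comm Complex.I]

/-- The Fourier transform of a tempered distribution. -/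
def fourierDist {n : ℕ} (t : 𝓢'(Config n, ℂ)) : 𝓢'(Config n, ℂ) :=
  PointwiseConvergenceCLM.precomp ℂ (fourierTest n) t

theorem fourierDist_apply {n : ℕ} (t : 𝓢'(Config n, ℂ)) (g : 𝓢(Config n, ℂ)) :
    fourierDist t g = t (fourierTest n g) := rfl

/-- The map `(q_1,…,q_n) ↦ (q_1,…,q_n,-q_1-⋯-q_n)`. -/
def conserve (n : ℕ) : Config n →L[ℝ] Config (n + 1) :=
  LinearMap.toContinuousLinearMap
    { toFun := fun q => WithLp.toLp 2 fun jμ : Fin (n + 1) × Fin 4 =>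
        Fin.snoc (α := fun _ => ℝ) (fun j => q (j, jμ.2)) (-∑ j, q (j, jμ.2)) jμ.1
      map_add' := fun q q' => by
        ext ⟨j, μ⟩
        refine Fin.lastCases ?_ (fun j => ?_) j
        · simp [Finset.sum_add_distrib, add_comm]
        · simp
      map_smul' := fun c q => by
        ext ⟨j, μ⟩
        refine Fin.lastCases ?_ (fun j => ?_) j
        · simp [Finset.mul_sum]
        · simp }

theorem conserve_castSucc (n : ℕ) (q : Config n) (j : Fin n) (μ : Fin 4) :
    conserve n q (j.castSucc, μ) = q (j, μ) := by
  simp [conserve]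

theorem conserve_last (n : ℕ) (q : Config n) (μ : Fin 4) :
    conserve n q (Fin.last n, μ) = -∑ j, q (j, μ) := by
  simp [conserve]

theorem norm_le_norm_conserve (n : ℕ) (q : Config n) : ‖q‖ ≤ ‖conserve n q‖ := by
  rw [EuclideanSpace.norm_eq, EuclideanSpace.norm_eq]
  refine Real.sqrt_le_sqrt ?_
  rw [Fintype.sum_prod_type, Fintype.sum_prod_type, Fin.sum_univ_castSucc]
  simp only [conserve_castSucc]
  exact le_add_of_nonneg_right (Finset.sum_nonneg fun _ _ => by positivity)

/-- The distribution `δ(q_1 + ⋯ + q_{n+1}) τ(q_1, …, q_n)`. -/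
def deltaTimes {n : ℕ} (τ : 𝓢'(Config n, ℂ)) : 𝓢'(Config (n + 1), ℂ) :=
  PointwiseConvergenceCLM.precomp ℂ
    (SchwartzMap.compCLMOfAntilipschitz ℂ (K := 1) (conserve n).hasTemperateGrowth
      (ContinuousLinearMap.antilipschitz_of_bound _ fun q => by
        simpa using norm_le_norm_conserve n q)) τ

/-- The normalization condition for the weak adiabatic limit, for a model with interaction
vertices `L`. -/
def TimeOrdered.WeakAdiabatic {M : FieldContent} (T : TimeOrdered M) {r : ℕ}
    (L : Fin r → M.SymField) : Prop :=
  ∀ (n : ℕ) (l : Fin (n + 1) → Fin r) (u : Fin (n + 1) → M.Index), (∀ j, (u j).OnlyMassless) →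
    ∃ τ : 𝓢'(Config n, ℂ),
      fourierDist (T.vev (n + 1) fun j => subPoly (L (l j)) (u j)) =
        (2 * Real.pi : ℂ) ^ 4 • deltaTimes τ ∧
      HasZeroOfOrder τ (4 - ∑ j, (u j).dim)

end CPT

end

/-!
The vacuum expectation value `t` of `T(L^{(u_1)}, …, L^{(u_k)})`, `k = n + 1`, has two properties.

* It is almost homogeneous. The derivatives `L^{(u)}` are again homogeneous, of dimension
  `4 - dim(A^u)` (`exists_subPoly_mem`, from the graded Leibniz rule), so that a power of
  `eulerShift D`, `D = ∑ (4 - dim(A^{u_j}))`, annihilates `t`.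
* It is translation invariant, because the vacuum is (`vev_compSubConstCLM`).

Translation invariance means that the components of the total momentum `Q = q_1 + ⋯ + q_k`
annihilate the Fourier transform of `t`. Such a distribution only sees the restriction of a test
function to `Q = 0` (`clm_eq_of_coord_mul_eq_zero`): a test function `g` is deformed into the
product of its restriction to `Q = 0` with a fixed test function of `Q`, along a curve whose
derivative is a combination of multiples of the components of `Q`. This gives `τ`
(`exists_fourierDist_eq_deltaTimes`). As the Euler operator commutes with linear maps and is
conjugated to its transpose by the Fourier transform, `τ` vanishes on the range of a power of
`∑ q_i ∂_i + D`.

With `N = 4n` one has `D = N + ω`. For a test function `g`, the function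
`λ ↦ λ ^ D * τ(g(λ ·))` therefore satisfies an ordinary differential equation which bounds it by
`λ ^ η` for every `η > 0` as `λ → ∞` (`exists_norm_clm_dilate_le`); this absorbs the logarithms.
Pairing `∂^γ τ` with `ε^{-N} g(·/ε)` thus gives `O(ε ^ (ω - |γ| - η))`, which tends to zero if
`|γ| < ω` (`hasZeroOfOrder_of_iterate_eulerAdd`).

Both uses of differentiation along a curve of test functions are instances of
`hasDerivAt_clm_comp_linear`, which reduces differentiation of `s ↦ T(Θ ∘ L_s)` for linear maps
`L_s` to the convergence of the difference quotients of translations in the Schwartz space.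
-/

namespace SchwartzMap

variable {E F : Type} [NormedAddCommGroup E] [NormedSpace ℝ E]
  [NormedAddCommGroup F] [NormedSpace ℝ F]

/-! ### Differentiating a distribution along curves of test functions -/

theorem exists_norm_pow_mul_translate_le (g : 𝓢(E, F)) (v : E) (k : ℕ) :
    ∃ C, 0 ≤ C ∧ ∀ (x : E) (s : ℝ), |s| ≤ 1 → ‖x‖ ^ k * ‖g (x + s • v)‖ ≤ C := by
  refine ⟨2 ^ (k - 1) * (SchwartzMap.seminorm ℝ k 0 g + ‖v‖ ^ k * SchwartzMap.seminorm ℝ 0 0 g),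
    by positivity, fun x s hs => ?_⟩
  have h1 : ‖x‖ ≤ ‖x + s • v‖ + ‖v‖ := by
    calc ‖x‖ = ‖x + s • v - s • v‖ := by simp
      _ ≤ ‖x + s • v‖ + ‖s • v‖ := norm_sub_le _ _
      _ ≤ _ := by
        rw [norm_smul, Real.norm_eq_abs]
        gcongr
        exact mul_le_of_le_one_left (norm_nonneg _) hs
  have h2 : ‖x‖ ^ k ≤ 2 ^ (k - 1) * (‖x + s • v‖ ^ k + ‖v‖ ^ k) :=
    (pow_le_pow_left₀ (norm_nonneg _) h1 k).trans (add_pow_le (norm_nonneg _) (norm_nonneg _) k)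
  calc ‖x‖ ^ k * ‖g (x + s • v)‖
      ≤ 2 ^ (k - 1) * (‖x + s • v‖ ^ k + ‖v‖ ^ k) * ‖g (x + s • v)‖ := by gcongr
    _ = 2 ^ (k - 1) * (‖x + s • v‖ ^ k * ‖g (x + s • v)‖ + ‖v‖ ^ k * ‖g (x + s • v)‖) := by ring
    _ ≤ _ := by
      gcongr
      · exact norm_pow_mul_le_seminorm ℝ g k _
      · exact norm_le_seminorm ℝ g _

theorem hasDerivAt_translate (g : 𝓢(E, F)) (x v : E) (s : ℝ) :
    HasDerivAt (fun s : ℝ => g (x + s • v)) (fderiv ℝ g (x + s • v) v) s := by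
  have h : HasDerivAt (fun s : ℝ => x + s • v) v s := by
    simpa using ((hasDerivAt_id s).smul_const v).const_add x
  exact (g.hasFDerivAt (x + s • v)).comp_hasDerivAt s h

theorem exists_norm_pow_mul_translate_sub_le (g : 𝓢(E, F)) (v : E) (k : ℕ) :
    ∃ C, 0 ≤ C ∧ ∀ (x : E) (s : ℝ), |s| ≤ 1 → ‖x‖ ^ k * ‖g (x + s • v) - g x‖ ≤ C * |s| := by
  obtain ⟨C, hC, h⟩ := exists_norm_pow_mul_translate_le (fderivCLM ℝ E F g) v k
  refine ⟨C * ‖v‖, by positivity, fun x s hs => ?_⟩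
  have h1 := (convex_Icc (-1 : ℝ) 1).norm_image_sub_le_of_norm_hasDerivWithin_le
    (f := fun s : ℝ => ‖x‖ ^ k • g (x + s • v)) (C := C * ‖v‖) (x := 0) (y := s)
    (fun r _ => ((hasDerivAt_translate g x v r).const_smul (‖x‖ ^ k)).hasDerivWithinAt)
    (fun r hr => by
      rw [norm_smul, norm_pow, norm_norm]
      calc ‖x‖ ^ k * ‖fderiv ℝ g (x + r • v) v‖
          ≤ ‖x‖ ^ k * (‖fderiv ℝ g (x + r • v)‖ * ‖v‖) := by
            gcongr; exact ContinuousLinearMap.le_opNorm _ _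
        _ = ‖x‖ ^ k * ‖fderivCLM ℝ E F g (x + r • v)‖ * ‖v‖ := by rw [fderivCLM_apply, mul_assoc]
        _ ≤ C * ‖v‖ := by gcongr; exact h x r (abs_le.mpr hr))
    (by simp) (by simpa [abs_le] using hs)
  rw [← smul_sub, norm_smul] at h1
  simpa using h1

/-- The remainder of the first order Taylor expansion of a translation. -/
noncomputable def translateRemainder (v : E) (s : ℝ) (g : 𝓢(E, F)) : 𝓢(E, F) :=
  compSubConstCLM ℝ (-(s • v)) g - g - s • (∂_{v} g)

theorem translateRemainder_apply (v : E) (s : ℝ) (g : 𝓢(E, F)) (x : E) :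
    translateRemainder v s g x = g (x + s • v) - g x - s • fderiv ℝ g x v := by
  simp [translateRemainder, lineDerivOp_apply_eq_fderiv]

theorem fderivCLM_translateRemainder (v : E) (s : ℝ) (g : 𝓢(E, F)) :
    fderivCLM ℝ E F (translateRemainder v s g) = translateRemainder v s (fderivCLM ℝ E F g) := by
  ext1 x
  rw [translateRemainder_apply, fderivCLM_apply]
  have h0 : (translateRemainder v s g : E → F) =
      fun x => g (x + s • v) - g x - s • fderiv ℝ g x v := by
    funext x; exact translateRemainder_apply v s g x
  have h1 : HasFDerivAt (fun x => g (x + s • v)) (fderiv ℝ g (x + s • v)) x := by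
    exact (g.hasFDerivAt (x + s • v)).comp x ((hasFDerivAt_id x).add_const (s • v))
  have h2 : HasFDerivAt (fun x => fderiv ℝ g x v)
      ((fderiv ℝ (fderivCLM ℝ E F g) x).flip v) x := by
    have := ((fderivCLM ℝ E F g).hasFDerivAt x).clm_apply (hasFDerivAt_const v x)
    simpa [fderivCLM_apply] using this
  rw [h0]
  refine ((h1.sub (g.hasFDerivAt x)).sub (h2.const_smul s)).fderiv.trans ?_
  have hsymm : (fderiv ℝ (fderivCLM ℝ E F g) x).flip v = fderiv ℝ (fderivCLM ℝ E F g) x v := by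
    ext w
    rw [ContinuousLinearMap.flip_apply]
    have hd : ∀ᶠ y in 𝓝 x, HasFDerivAt g (fderivCLM ℝ E F g y) y :=
      Eventually.of_forall fun y => g.hasFDerivAt y
    exact second_derivative_symmetric_of_eventually hd ((fderivCLM ℝ E F g).hasFDerivAt x) w v
  rw [hsymm]
  simp [fderivCLM_apply]

theorem exists_norm_pow_mul_translateRemainder_le (g : 𝓢(E, F)) (v : E) (k : ℕ) :
    ∃ C, 0 ≤ C ∧ ∀ (x : E) (s : ℝ), |s| ≤ 1 →
      ‖x‖ ^ k * ‖translateRemainder v s g x‖ ≤ C * |s| ^ 2 := by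
  obtain ⟨C, hC, h⟩ := exists_norm_pow_mul_translate_sub_le (fderivCLM ℝ E F g) v k
  refine ⟨C * ‖v‖, by positivity, fun x s hs => ?_⟩
  have h1 := (convex_Icc (-|s|) |s|).norm_image_sub_le_of_norm_hasDerivWithin_le
    (f := fun s : ℝ => ‖x‖ ^ k • (g (x + s • v) - s • fderiv ℝ g x v))
    (C := C * |s| * ‖v‖) (x := 0) (y := s)
    (fun r _ => (((hasDerivAt_translate g x v r).sub
      ((hasDerivAt_id r).smul_const (fderiv ℝ g x v))).const_smul (‖x‖ ^ k)).hasDerivWithinAt)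
    (fun r hr => by
      have hr' : |r| ≤ |s| := abs_le.mpr hr
      rw [norm_smul, norm_pow, norm_norm, one_smul, ← sub_apply]
      calc ‖x‖ ^ k * ‖(fderiv ℝ g (x + r • v) - fderiv ℝ g x) v‖
          ≤ ‖x‖ ^ k * (‖fderiv ℝ g (x + r • v) - fderiv ℝ g x‖ * ‖v‖) := by
            gcongr; exact ContinuousLinearMap.le_opNorm _ _
        _ = ‖x‖ ^ k * ‖fderivCLM ℝ E F g (x + r • v) - fderivCLM ℝ E F g x‖ * ‖v‖ := by
            rw [fderivCLM_apply, fderivCLM_apply, mul_assoc]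
        _ ≤ C * |r| * ‖v‖ := mul_le_mul_of_nonneg_right (h x r (hr'.trans hs)) (norm_nonneg _)
        _ ≤ C * |s| * ‖v‖ := by gcongr)
    (by simp) (by simp [neg_abs_le, le_abs_self])
  rw [← smul_sub, norm_smul, norm_pow, norm_norm] at h1
  rw [translateRemainder_apply]
  refine (le_of_eq ?_).trans (h1.trans (le_of_eq ?_))
  · congr 2
    simp only [zero_smul, add_zero, sub_zero]
    abel
  · simp only [sub_zero, Real.norm_eq_abs]; ring

/-- Differentiation commutes with `translateRemainder`, so the bound for all seminorms follows from
that of the function itself. -/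
theorem exists_seminorm_translateRemainder_le (v : E) (k l : ℕ) : ∀ {F : Type}
    [NormedAddCommGroup F] [NormedSpace ℝ F] (g : 𝓢(E, F)), ∃ C, 0 ≤ C ∧ ∀ s : ℝ, |s| ≤ 1 →
      SchwartzMap.seminorm ℝ k l (translateRemainder v s g) ≤ C * |s| ^ 2 := by
  induction l with
  | zero =>
    intro F _ _ g
    obtain ⟨C, hC, h⟩ := exists_norm_pow_mul_translateRemainder_le g v k
    refine ⟨C, hC, fun s hs => seminorm_le_bound ℝ k 0 _ (by positivity) fun x => ?_⟩
    simpa using h x s hs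
  | succ l ih =>
    intro F _ _ g
    obtain ⟨C, hC, h⟩ := ih (fderivCLM ℝ E F g)
    refine ⟨C, hC, fun s hs => seminorm_le_bound ℝ k (l + 1) _ (by positivity) fun x => ?_⟩
    refine le_trans (le_of_eq ?_) ((le_seminorm ℝ k l _ x).trans (h s hs))
    rw [← fderivCLM_translateRemainder, ← norm_iteratedFDeriv_fderiv]
    rfl

theorem tendsto_translate_slope (g : 𝓢(E, F)) (v : E) :
    Tendsto (fun s : ℝ => s⁻¹ • (compSubConstCLM ℝ (-(s • v)) g - g)) (𝓝[≠] 0) (𝓝 (∂_{v} g)) := by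
  refine ((schwartz_withSeminorms ℝ E F).tendsto_nhds _ _).mpr fun ⟨k, l⟩ ε hε => ?_
  obtain ⟨C, hC, h⟩ := exists_seminorm_translateRemainder_le v k l g
  have h1 : ∀ᶠ s : ℝ in 𝓝[≠] 0, |s| < min 1 (ε / (C + 1)) := by
    refine nhdsWithin_le_nhds ?_
    have : Tendsto (fun s : ℝ => |s|) (𝓝 0) (𝓝 0) := by
      simpa using (continuous_abs (G := ℝ)).tendsto 0
    exact this.eventually_lt_const (by positivity)
  filter_upwards [h1, self_mem_nhdsWithin] with s hs hs0
  have hs0 : s ≠ 0 := hs0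
  have h2 : s⁻¹ • (compSubConstCLM ℝ (-(s • v)) g - g) - ∂_{v} g =
      s⁻¹ • translateRemainder v s g := by
    rw [translateRemainder, smul_sub _ (_ - _), smul_smul, inv_mul_cancel₀ hs0, one_smul]
  rw [h2, map_smul_eq_mul, SchwartzMap.schwartzSeminormFamily_apply, norm_inv, Real.norm_eq_abs]
  have hs1 : |s| < 1 := hs.trans_le (min_le_left _ _)
  have hs2 : |s| < ε / (C + 1) := hs.trans_le (min_le_right _ _)
  have hpos : 0 < |s| := abs_pos.mpr hs0
  calc |s|⁻¹ * SchwartzMap.seminorm ℝ k l (translateRemainder v s g)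
      ≤ |s|⁻¹ * (C * |s| ^ 2) := by gcongr; exact h s hs1.le
    _ = C * |s| := by field_simp
    _ ≤ (C + 1) * |s| := by gcongr; linarith
    _ < ε := by rwa [lt_div_iff₀' (by positivity)] at hs2

theorem hasDerivAt_clm_translate (T : 𝓢(E, F) →L[ℝ] ℂ) (g : 𝓢(E, F)) (v : E) (s : ℝ) :
    HasDerivAt (fun s : ℝ => T (compSubConstCLM ℝ (-(s • v)) g))
      (T (compSubConstCLM ℝ (-(s • v)) (∂_{v} g))) s := by
  rw [hasDerivAt_iff_tendsto_slope_zero]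
  have h := ((T ∘L compSubConstCLM ℝ (-(s • v))).continuous.tendsto _).comp
    (tendsto_translate_slope g v)
  refine h.congr fun r => ?_
  have h1 : compSubConstCLM ℝ (-((s + r) • v)) g =
      compSubConstCLM ℝ (-(s • v)) (compSubConstCLM ℝ (-(r • v)) g) := by
    ext x
    simp only [compSubConstCLM_apply]
    congr 1
    module
  simp [h1]

end SchwartzMap

namespace SchwartzMap

section Tensor

variable {E₁ E₂ : Type} [NormedAddCommGroup E₁] [NormedSpace ℝ E₁]
  [NormedAddCommGroup E₂] [NormedSpace ℝ E₂]

theorem norm_iteratedFDeriv_comp_le_of_norm_le_one {E D : Type} [NormedAddCommGroup E]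
    [NormedSpace ℝ E] [NormedAddCommGroup D] [NormedSpace ℝ D] (g : 𝓢(E, ℂ)) (A : D →L[ℝ] E)
    (hA : ‖A‖ ≤ 1) (i : ℕ) (z : D) :
    ‖iteratedFDeriv ℝ i (fun z => g (A z)) z‖ ≤ ‖iteratedFDeriv ℝ i g (A z)‖ := by
  have h := A.iteratedFDeriv_comp_right (g.smooth ⊤) z (i := i) (mod_cast le_top)
  have h' : iteratedFDeriv ℝ i (fun z => g (A z)) z = _ := h
  rw [h']
  refine (ContinuousMultilinearMap.norm_compContinuousLinearMap_le _ _).trans ?_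
  refine mul_le_of_le_one_right (norm_nonneg _) ?_
  rw [Finset.prod_const]
  exact pow_le_one₀ (norm_nonneg _) hA

/-- Multiplication by a test function `g` of further variables: `f` is mapped to the function
`(x, y) ↦ f x * g y`. -/
noncomputable def tensorCLM (g : 𝓢(E₂, ℂ)) : 𝓢(E₁, ℂ) →L[ℂ] 𝓢(E₁ × E₂, ℂ) :=
  mkCLM (fun f z => f z.1 * g z.2) (fun _ _ _ => add_mul _ _ _) (fun _ _ _ => mul_assoc _ _ _)
    (fun f => ((f.smooth ⊤).comp contDiff_fst).mul ((g.smooth ⊤).comp contDiff_snd)) <| by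
  rintro ⟨k, n⟩
  set B := 2 ^ k * ((Finset.Iic (k, n)).sup (schwartzSeminormFamily ℂ E₂ ℂ)) g with hB
  refine ⟨Finset.Iic (k, n), ∑ i ∈ Finset.range (n + 1), (n.choose i : ℝ) * (2 ^ k * B),
    by positivity, fun f z => ?_⟩
  set A := ((Finset.Iic (k, n)).sup (schwartzSeminormFamily ℂ E₁ ℂ)) f with hA
  have hz : ‖z‖ ^ k ≤ (1 + ‖z.1‖) ^ k * (1 + ‖z.2‖) ^ k := by
    rw [← mul_pow]
    refine pow_le_pow_left₀ (norm_nonneg _) ?_ k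
    have h1 := norm_nonneg z.1
    have h2 := norm_nonneg z.2
    rw [Prod.norm_def]
    refine max_le ?_ ?_ <;> nlinarith
  have hmul := norm_iteratedFDeriv_mul_le (𝕜 := ℝ) (f := fun z : E₁ × E₂ => f z.1)
    (g := fun z : E₁ × E₂ => g z.2) (N := (⊤ : ℕ∞)) (n := n)
    ((f.smooth ⊤).comp contDiff_fst) ((g.smooth ⊤).comp contDiff_snd) z (mod_cast le_top)
  refine (mul_le_mul hz hmul (norm_nonneg _) (by positivity)).trans ?_
  rw [Finset.mul_sum, Finset.sum_mul]
  refine Finset.sum_le_sum fun i hi => ?_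
  have hi' : i ≤ n := Nat.lt_succ_iff.mp (Finset.mem_range.mp hi)
  have h1 : (1 + ‖z.1‖) ^ k * ‖iteratedFDeriv ℝ i (fun z : E₁ × E₂ => f z.1) z‖ ≤ 2 ^ k * A := by
    refine le_trans ?_ (one_add_le_sup_seminorm_apply (𝕜 := ℂ) (m := (k, n)) le_rfl hi' f z.1)
    gcongr
    exact norm_iteratedFDeriv_comp_le_of_norm_le_one f (.fst ℝ E₁ E₂)
      (ContinuousLinearMap.norm_fst_le _ _ _) i z
  have h2 : (1 + ‖z.2‖) ^ k * ‖iteratedFDeriv ℝ (n - i) (fun z : E₁ × E₂ => g z.2) z‖ ≤ B := by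
    refine le_trans ?_ (one_add_le_sup_seminorm_apply (𝕜 := ℂ) (m := (k, n)) le_rfl
      (Nat.sub_le n i) g z.2)
    gcongr
    exact norm_iteratedFDeriv_comp_le_of_norm_le_one g (.snd ℝ E₁ E₂)
      (ContinuousLinearMap.norm_snd_le _ _ _) (n - i) z
  calc _ = (n.choose i : ℝ) *
        (((1 + ‖z.1‖) ^ k * ‖iteratedFDeriv ℝ i (fun z : E₁ × E₂ => f z.1) z‖) *
        ((1 + ‖z.2‖) ^ k * ‖iteratedFDeriv ℝ (n - i) (fun z : E₁ × E₂ => g z.2) z‖)) := by ring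
    _ ≤ (n.choose i : ℝ) * ((2 ^ k * A) * B) := by gcongr
    _ = (n.choose i : ℝ) * (2 ^ k * B) * A := by ring

theorem tensorCLM_apply (g : 𝓢(E₂, ℂ)) (f : 𝓢(E₁, ℂ)) (z : E₁ × E₂) :
    tensorCLM g f z = f z.1 * g z.2 := rfl

end Tensor

theorem exists_eventually_eq_one {W : Type} [NormedAddCommGroup W] [InnerProductSpace ℝ W]
    [FiniteDimensional ℝ W] (c : W) : ∃ w : 𝓢(W, ℂ), ∀ᶠ s in 𝓝 c, w s = 1 := by
  let b : ContDiffBump c := default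
  have h1 : HasCompactSupport fun s => ((b s : ℝ) : ℂ) :=
    b.hasCompactSupport.comp_left (g := fun r : ℝ => (r : ℂ)) (by simp)
  have h2 : ContDiff ℝ (⊤ : ℕ∞) fun s => ((b s : ℝ) : ℂ) :=
    Complex.ofRealCLM.contDiff.comp b.contDiff
  refine ⟨h1.toSchwartzMap h2, ?_⟩
  filter_upwards [b.eventuallyEq_one] with s hs
  change ((b s : ℝ) : ℂ) = 1
  simp [hs]

section Curve

variable {V X : Type} [NormedAddCommGroup V] [NormedSpace ℝ V]
  [NormedAddCommGroup X] [NormedSpace ℝ X]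

theorem hasTemperateGrowth_prodMk {D : Type} [NormedAddCommGroup D] [NormedSpace ℝ D]
    {f : D → V} {g : D → X} (hf : f.HasTemperateGrowth) (hg : g.HasTemperateGrowth) :
    (fun z => (f z, g z)).HasTemperateGrowth := by
  have h := ((ContinuousLinearMap.inl ℝ V X).hasTemperateGrowth.comp hf).add
    ((ContinuousLinearMap.inr ℝ V X).hasTemperateGrowth.comp hg)
  convert h using 1
  funext z
  simp

/-- Differentiation of `s ↦ T(Θ ∘ L_s)` for a family `L_s` of linear maps. After localisation in
`s`, the functions `Θ ∘ L_s` are the slices of a Schwartz function of `(s, x)`, so that this is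
differentiation along a translation in the direction of `s`. -/
theorem hasDerivAt_clm_comp_linear {L : ℝ → V →L[ℝ] X} (hL : L.HasTemperateGrowth) {C : ℝ}
    (hC : ∀ s x, ‖x‖ ≤ C * ‖L s x‖) (Θ : 𝓢(X, ℂ)) (T : 𝓢(V, ℂ) →L[ℝ] ℂ) {F : ℝ → 𝓢(V, ℂ)}
    (hF : ∀ s x, F s x = Θ (L s x)) {s₀ : ℝ} {L' : V →L[ℝ] X} (hL' : HasDerivAt L L' s₀)
    {F' : 𝓢(V, ℂ)} (hF' : ∀ x, F' x = fderiv ℝ Θ (L s₀ x) (L' x)) :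
    HasDerivAt (fun s => T (F s)) (T F') s₀ := by
  obtain ⟨w, hw⟩ := exists_eventually_eq_one s₀
  have hG : (fun z : ℝ × V => (z.1, L z.1 z.2)).HasTemperateGrowth := by
    refine hasTemperateGrowth_prodMk (ContinuousLinearMap.fst ℝ ℝ V).hasTemperateGrowth ?_
    exact (ContinuousLinearMap.id ℝ (V →L[ℝ] X)).bilinear_hasTemperateGrowth
      (hL.comp (ContinuousLinearMap.fst ℝ ℝ V).hasTemperateGrowth)
      (ContinuousLinearMap.snd ℝ ℝ V).hasTemperateGrowth
  have hG' : ∃ (k : ℕ) (C : ℝ), ∀ z : ℝ × V, ‖z‖ ≤ C * (1 + ‖(z.1, L z.1 z.2)‖) ^ k := by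
    refine ⟨1, max 1 C, fun z => ?_⟩
    rw [pow_one, Prod.norm_def, Prod.norm_def]
    have h0 : (0 : ℝ) ≤ ‖L z.1 z.2‖ := norm_nonneg _
    have h00 : (0 : ℝ) ≤ ‖z.1‖ := norm_nonneg _
    refine max_le ?_ ?_
    · have : ‖z.1‖ ≤ 1 + max ‖z.1‖ ‖L z.1 z.2‖ := by linarith [le_max_left ‖z.1‖ ‖L z.1 z.2‖]
      exact this.trans (le_mul_of_one_le_left (by positivity) (le_max_left _ _))
    · refine (hC z.1 z.2).trans ?_
      have : ‖L z.1 z.2‖ ≤ 1 + max ‖z.1‖ ‖L z.1 z.2‖ := by linarith [le_max_right ‖z.1‖ ‖L z.1 z.2‖]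
      exact mul_le_mul (le_max_right _ _) this h0 (by positivity)
  -- `Ψ (s, x) = w s * Θ (L s x)`, where `w` is equal to `1` near `s₀`.
  set Ψ : 𝓢(ℝ × V, ℂ) := compCLM ℝ hG hG' (tensorCLM Θ w) with hΨ
  have hΨa : ∀ s x, Ψ (s, x) = w s * Θ (L s x) := fun s x => rfl
  have hι : (fun x : V => (s₀, x)).HasTemperateGrowth :=
    hasTemperateGrowth_prodMk (.const s₀) .id'
  have hι' : AntilipschitzWith 1 (fun x : V => (s₀, x)) := by
    refine AntilipschitzWith.of_le_mul_dist fun x y => ?_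
    simp [Prod.dist_eq]
  set S : 𝓢(ℝ × V, ℂ) →L[ℝ] 𝓢(V, ℂ) := compCLMOfAntilipschitz ℝ hι hι' with hS
  have hSa : ∀ (Φ : 𝓢(ℝ × V, ℂ)) x, S Φ x = Φ (s₀, x) := fun Φ x => rfl
  have hd := hasDerivAt_clm_translate (T ∘L S) Ψ (1, 0) (s₀ - s₀)
  have hd' := HasDerivAt.comp_sub_const s₀ s₀ hd
  have hT : (T ∘L S) (compSubConstCLM ℝ (-((s₀ - s₀) • ((1 : ℝ), (0 : V))))
      (∂_{((1 : ℝ), (0 : V))} Ψ)) = T F' := by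
    rw [ContinuousLinearMap.comp_apply]
    congr 1
    ext x
    rw [hSa, compSubConstCLM_apply, lineDerivOp_apply_eq_fderiv, hF']
    simp only [sub_self, zero_smul, neg_zero, sub_zero]
    have e1 : HasDerivAt (fun s : ℝ => Ψ (s, x)) (fderiv ℝ Ψ (s₀, x) (1, 0)) s₀ := by
      have h : HasDerivAt (fun s : ℝ => (s, x)) ((1 : ℝ), (0 : V)) s₀ :=
        (hasDerivAt_id s₀).prodMk (hasDerivAt_const s₀ x)
      exact (Ψ.hasFDerivAt (s₀, x)).comp_hasDerivAt s₀ h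
    have e2 : HasDerivAt (fun s : ℝ => Θ (L s x)) (fderiv ℝ Θ (L s₀ x) (L' x)) s₀ := by
      have h : HasDerivAt (fun s : ℝ => L s x) (L' x) s₀ := by
        simpa using hL'.clm_apply (hasDerivAt_const s₀ x)
      exact (Θ.hasFDerivAt (L s₀ x)).comp_hasDerivAt s₀ h
    refine e1.unique (e2.congr_of_eventuallyEq ?_)
    filter_upwards [hw] with s hs
    rw [hΨa, hs, one_mul]
  rw [hT] at hd'
  refine hd'.congr_of_eventuallyEq ?_
  filter_upwards [hw] with s hs
  rw [ContinuousLinearMap.comp_apply]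
  congr 1
  ext x
  rw [hSa, compSubConstCLM_apply, hF]
  have : ((s₀, x) : ℝ × V) - -((s - s₀) • ((1 : ℝ), (0 : V))) = (s, x) := by
    ext <;> simp
  rw [this, hΨa, hs, one_mul]

end Curve

end SchwartzMap

namespace SchwartzMap

/-! ### Distributions annihilated by coordinate functions -/

section Factor

variable {V ι : Type} [NormedAddCommGroup V] [NormedSpace ℝ V] [Fintype ι] [DecidableEq ι]

/-- A distribution annihilated by the coordinates of `Q` is supported on `Q = 0` without transversal
derivatives: it only sees the restriction of test functions to the range of the projection `P` onto
`Q = 0`. The test functions `g` and `g' = g(P ·) χ(Q ·)` are joined by the curve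
`g(P x + (1 - s) J Q x) χ(s Q x)`, whose `s`-derivative is a combination of multiples of the
coordinates of `Q`. -/
theorem clm_eq_of_coord_mul_eq_zero (P : V →L[ℝ] V) (Q : V →L[ℝ] EuclideanSpace ℝ ι)
    (J : EuclideanSpace ℝ ι →L[ℝ] V) (hPQ : ∀ x, P x + J (Q x) = x) (T : 𝓢(V, ℂ) →L[ℝ] ℂ)
    (hT : ∀ (μ : ι) (g : 𝓢(V, ℂ)), T (smulLeftCLM ℂ (fun x => (Q x μ : ℂ)) g) = 0)
    {χ : 𝓢(EuclideanSpace ℝ ι, ℂ)} (hχ : χ 0 = 1) {g g' : 𝓢(V, ℂ)}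
    (hg : ∀ x, g' x = g (P x) * χ (Q x)) : T g = T g' := by
  -- `L s x = (x - s • J (Q x), s • Q x)`, where `x - s • J (Q x) = P x + (1 - s) • J (Q x)`.
  set A : V →L[ℝ] V × EuclideanSpace ℝ ι := (ContinuousLinearMap.id ℝ V).prod 0 with hA
  set B : V →L[ℝ] V × EuclideanSpace ℝ ι := (-(J ∘L Q)).prod Q with hB
  set L : ℝ → V →L[ℝ] V × EuclideanSpace ℝ ι := fun s => A + s • B with hLdef
  have hLa : ∀ s x, L s x = (x - s • J (Q x), s • Q x) := by
    intro s x
    simp [hLdef, hA, hB, sub_eq_add_neg]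
  have hL : L.HasTemperateGrowth := by
    refine (Function.HasTemperateGrowth.const A).add ?_
    exact Function.HasTemperateGrowth.id'.smul (.const B)
  have hC : ∀ s x, ‖x‖ ≤ (1 + ‖J‖) * ‖L s x‖ := by
    intro s x
    have h1 : x = (L s x).1 + J (L s x).2 := by
      rw [hLa]
      simp
    calc ‖x‖ = ‖(L s x).1 + J (L s x).2‖ := by rw [← h1]
      _ ≤ ‖(L s x).1‖ + ‖J‖ * ‖(L s x).2‖ :=
        (norm_add_le _ _).trans (by gcongr; exact J.le_opNorm _)
      _ ≤ ‖L s x‖ + ‖J‖ * ‖L s x‖ := by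
        gcongr
        · exact norm_fst_le _
        · exact norm_snd_le _
      _ = _ := by ring
  have hC' : ∀ s, ∃ (k : ℕ) (C : ℝ), ∀ x, ‖x‖ ≤ C * (1 + ‖L s x‖) ^ k := fun s =>
    ⟨1, 1 + ‖J‖, fun x => by
      rw [pow_one]
      refine (hC s x).trans ?_
      gcongr
      linarith⟩
  let K : ℝ → 𝓢(V × EuclideanSpace ℝ ι, ℂ) →L[ℝ] 𝓢(V, ℂ) := fun s =>
    compCLM ℝ (L s).hasTemperateGrowth (hC' s)
  have hK : ∀ s Φ x, K s Φ x = Φ (L s x) := fun s Φ x => rfl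
  let dir : ι → V × EuclideanSpace ℝ ι := fun μ =>
    (-J (EuclideanSpace.single μ 1), EuclideanSpace.single μ 1)
  have hdir : ∀ x, B x = ∑ μ, Q x μ • dir μ := by
    intro x
    have hq : Q x = ∑ μ, Q x μ • EuclideanSpace.single μ (1 : ℝ) := by
      ext ν
      simp [Pi.single_apply]
    have hb : ∀ w : EuclideanSpace ℝ ι,
        (-(J w), w) = ((-J).prod (ContinuousLinearMap.id ℝ _)) w := fun w => rfl
    have : B x = ((-J).prod (ContinuousLinearMap.id ℝ _)) (Q x) := rfl
    rw [this]
    conv_lhs => rw [hq]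
    rw [map_sum]
    refine Finset.sum_congr rfl fun μ _ => ?_
    rw [map_smul]
    rfl
  have hQt : ∀ μ, (fun x => (Q x μ : ℂ)).HasTemperateGrowth := fun μ =>
    (Complex.ofRealCLM ∘L EuclideanSpace.proj μ ∘L Q).hasTemperateGrowth
  have hderiv : ∀ s, HasDerivAt (fun s => T (K s (tensorCLM χ g))) 0 s := by
    intro s
    have hL' : HasDerivAt L B s := by
      simpa [hLdef] using ((hasDerivAt_id s).smul_const B).const_add A
    have h := hasDerivAt_clm_comp_linear hL hC (tensorCLM χ g) T (F := fun s => K s (tensorCLM χ g))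
      (fun s x => rfl) hL'
      (F' := ∑ μ, smulLeftCLM ℂ (fun x => (Q x μ : ℂ)) (K s (∂_{dir μ} (tensorCLM χ g)))) (by
        intro x
        rw [hdir, map_sum, sum_apply]
        refine Finset.sum_congr rfl fun μ _ => ?_
        rw [smulLeftCLM_apply_apply (hQt μ), hK, lineDerivOp_apply_eq_fderiv, map_smul]
        simp)
    rw [map_sum] at h
    simpa [hT] using h
  have hconst := is_const_of_deriv_eq_zero (fun s => (hderiv s).differentiableAt)
    (fun s => (hderiv s).deriv) 0 1
  have h0 : K 0 (tensorCLM χ g) = g := by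
    ext x
    rw [hK, hLa, tensorCLM_apply]
    simp [hχ]
  have h1 : K 1 (tensorCLM χ g) = g' := by
    ext x
    rw [hK, hLa, tensorCLM_apply, hg]
    have : x - (1 : ℝ) • J (Q x) = P x := by
      rw [one_smul, sub_eq_iff_eq_add]
      exact (hPQ x).symm
    rw [this]
    simp
  rwa [h0, h1] at hconst

end Factor

/-! ### The Euler operator and almost homogeneous distributions -/

section Euler

variable {V : Type} [NormedAddCommGroup V] [NormedSpace ℝ V]

/-- The Euler operator `∑ j, x_j ∂_j` shifted by a constant: `g ↦ (x ↦ g'(x) x + c g(x))`. -/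
noncomputable def eulerAdd (c : ℝ) : 𝓢(V, ℂ) →L[ℝ] 𝓢(V, ℂ) :=
  bilinLeftCLM (ContinuousLinearMap.id ℝ (V →L[ℝ] ℂ)) (g := fun x : V => x) .id' ∘L
    fderivCLM ℝ V ℂ + c • ContinuousLinearMap.id ℝ _

theorem eulerAdd_apply (c : ℝ) (g : 𝓢(V, ℂ)) (x : V) :
    eulerAdd c g x = fderiv ℝ g x x + c * g x := by
  simp [eulerAdd, fderivCLM_apply]

/-- The dilation `g(a ·)`. -/
noncomputable def dilate (a : ℝˣ) : 𝓢(V, ℂ) →L[ℝ] 𝓢(V, ℂ) :=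
  compCLMOfContinuousLinearEquiv ℝ (ContinuousLinearEquiv.smulLeft a)

theorem dilate_apply (a : ℝˣ) (g : 𝓢(V, ℂ)) (x : V) : dilate a g x = g ((a : ℝ) • x) := rfl

/-- The Euler operator commutes with linear maps. -/
theorem eulerAdd_apply_of_comp_linear {X : Type} [NormedAddCommGroup X] [NormedSpace ℝ X]
    (A : V →L[ℝ] X) {g : 𝓢(X, ℂ)} {g' : 𝓢(V, ℂ)} (h : ∀ x, g' x = g (A x)) (c : ℝ) (x : V) :
    eulerAdd c g' x = eulerAdd c g (A x) := by
  have h1 : HasFDerivAt g' (fderiv ℝ g (A x) ∘L A) x := by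
    have h2 : (g' : V → ℂ) = g ∘ A := funext h
    rw [h2]
    exact (g.hasFDerivAt (A x)).comp x A.hasFDerivAt
  rw [eulerAdd_apply, eulerAdd_apply, h1.fderiv, h]
  rfl

theorem iterate_eulerAdd_apply_of_comp_linear {X : Type} [NormedAddCommGroup X] [NormedSpace ℝ X]
    (A : V →L[ℝ] X) (c : ℝ) (m : ℕ) {g : 𝓢(X, ℂ)} {g' : 𝓢(V, ℂ)} (h : ∀ x, g' x = g (A x)) (x : V) :
    (eulerAdd c)^[m] g' x = (eulerAdd c)^[m] g (A x) := by
  induction m generalizing g g' with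
  | zero => exact h x
  | succ m ih =>
    rw [Function.iterate_succ_apply, Function.iterate_succ_apply]
    exact ih fun x => eulerAdd_apply_of_comp_linear A h c x

theorem iterate_eulerAdd_dilate (c : ℝ) (m : ℕ) (a : ℝˣ) (g : 𝓢(V, ℂ)) :
    (eulerAdd c)^[m] (dilate a g) = dilate a ((eulerAdd c)^[m] g) := by
  ext x
  exact iterate_eulerAdd_apply_of_comp_linear ((a : ℝ) • ContinuousLinearMap.id ℝ V) c m
    (fun x => dilate_apply a g x) x

/-- The number `1 + s²` as a unit. Parametrising the dilations by it makes them polynomial in the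
parameter. -/
noncomputable def oneAddSq (s : ℝ) : ℝˣ := Units.mk0 (1 + s ^ 2) (by positivity)

theorem hasDerivAt_clm_dilate (T : 𝓢(V, ℂ) →L[ℝ] ℂ) (g : 𝓢(V, ℂ)) (s : ℝ) :
    HasDerivAt (fun s => T (dilate (oneAddSq s) g))
      ((2 * s / (1 + s ^ 2) : ℝ) • T (dilate (oneAddSq s) (eulerAdd 0 g))) s := by
  set I := ContinuousLinearMap.id ℝ V
  have hpos : (0 : ℝ) < 1 + s ^ 2 := by positivity
  have h := hasDerivAt_clm_comp_linear (L := fun s => (1 + s ^ 2 : ℝ) • I) (C := 1)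
    (L' := (2 * s) • I) (s₀ := s)
    (((Function.HasTemperateGrowth.const (1 : ℝ)).add
      (Function.HasTemperateGrowth.id'.pow 2)).smul (.const I))
    (fun s x => by
      rw [one_mul]
      change ‖x‖ ≤ ‖(1 + s ^ 2) • x‖
      rw [norm_smul, Real.norm_of_nonneg (by positivity)]
      exact le_mul_of_one_le_left (norm_nonneg _) (by nlinarith))
    g T (F := fun s => dilate (oneAddSq s) g) (fun s x => rfl)
    (by
      have := (((hasDerivAt_id s).pow 2).const_add 1).smul_const I
      simpa using this)
    (F' := (2 * s / (1 + s ^ 2)) • dilate (oneAddSq s) (eulerAdd 0 g))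
    (fun x => by
      change (2 * s / (1 + s ^ 2)) • eulerAdd 0 g ((1 + s ^ 2) • x) =
        fderiv ℝ g ((1 + s ^ 2) • x) ((2 * s) • x)
      rw [eulerAdd_apply, (fderiv ℝ g _).map_smul, (fderiv ℝ g _).map_smul, smul_add,
        smul_smul, div_mul_cancel₀ _ hpos.ne']
      simp)
  rwa [map_smul] at h

/-- The factor `(1 + s²) ^ c` turns the Euler operator in the derivative of a dilation into the
shifted Euler operator. -/
theorem hasDerivAt_rpow_mul_clm_dilate (T : 𝓢(V, ℂ) →L[ℝ] ℂ) (c : ℝ) (g : 𝓢(V, ℂ)) (s : ℝ) :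
    HasDerivAt (fun s => ((1 + s ^ 2) ^ c : ℝ) • T (dilate (oneAddSq s) g))
      ((2 * s / (1 + s ^ 2) : ℝ) • ((1 + s ^ 2) ^ c : ℝ) •
        T (dilate (oneAddSq s) (eulerAdd c g))) s := by
  have hpos : (0 : ℝ) < 1 + s ^ 2 := by positivity
  have h1 : HasDerivAt (fun s : ℝ => (1 + s ^ 2) ^ c) (2 * s * c * (1 + s ^ 2) ^ (c - 1)) s := by
    have := (((hasDerivAt_id s).pow 2).const_add 1).rpow_const (p := c) (Or.inl hpos.ne')
    simpa using this
  refine (h1.smul (hasDerivAt_clm_dilate T g s)).congr_deriv ?_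
  have h2 : eulerAdd c g = eulerAdd 0 g + c • g := by
    ext x
    simp [eulerAdd_apply]
  rw [h2, map_add, map_smul, map_add, map_smul, Real.rpow_sub_one hpos.ne']
  simp only [smul_add, smul_smul]
  congr 2
  · ring
  · ring

/-- A distribution annihilated by a power of the transposed shifted Euler operator behaves under
dilations like a power with logarithmic corrections, which are bounded here by a small power. -/
theorem exists_norm_clm_dilate_le (T : 𝓢(V, ℂ) →L[ℝ] ℂ) (c : ℝ) {η : ℝ} (hη : 0 < η) (m : ℕ)
    (g : 𝓢(V, ℂ)) (h : ∀ a : ℝˣ, T (dilate a ((eulerAdd c)^[m] g)) = 0) :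
    ∃ C, ∀ s : ℝ, 0 ≤ s →
      ‖((1 + s ^ 2) ^ c : ℝ) • T (dilate (oneAddSq s) g)‖ ≤ C * (1 + s ^ 2) ^ η := by
  induction m generalizing g with
  | zero =>
    refine ⟨0, fun s _ => ?_⟩
    have := h (oneAddSq s)
    rw [Function.iterate_zero, id_eq] at this
    simp [this]
  | succ m ih =>
    obtain ⟨C, hC⟩ := ih (eulerAdd c g) h
    set f : ℝ → ℂ := fun s => ((1 + s ^ 2) ^ c : ℝ) • T (dilate (oneAddSq s) g) with hf
    refine ⟨‖f 0‖ + |C| / η, fun s hs => ?_⟩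
    have hb := image_norm_le_of_norm_deriv_right_le_deriv_boundary (a := 0) (b := s) (f := f)
      (B := fun s => ‖f 0‖ + |C| / η * ((1 + s ^ 2) ^ η - 1))
      (B' := fun s => |C| * (2 * s / (1 + s ^ 2) * (1 + s ^ 2) ^ η))
      (fun r _ => (hasDerivAt_rpow_mul_clm_dilate T c g r).continuousAt.continuousWithinAt)
      (fun r _ => (hasDerivAt_rpow_mul_clm_dilate T c g r).hasDerivWithinAt)
      (by simp)
      (fun r => by
        have hpos : (0 : ℝ) < 1 + r ^ 2 := by positivity
        have := ((((((hasDerivAt_id r).pow 2).const_add 1).rpow_const (p := η)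
          (Or.inl hpos.ne')).sub_const 1).const_mul (|C| / η)).const_add ‖f 0‖
        refine this.congr_deriv ?_
        rw [Real.rpow_sub_one (by simpa using hpos.ne')]
        simp
        field_simp)
      (fun r hr => by
        have hr0 : 0 ≤ 2 * r / (1 + r ^ 2) := by
          have := hr.1
          positivity
        rw [norm_smul, Real.norm_of_nonneg hr0]
        calc _ ≤ 2 * r / (1 + r ^ 2) * (|C| * (1 + r ^ 2) ^ η) := by
              gcongr
              refine (hC r hr.1).trans ?_
              gcongr
              exact le_abs_self C
          _ = _ := by ring)
      (Set.right_mem_Icc.mpr hs)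
    refine hb.trans ?_
    have h1 : (1 : ℝ) ≤ (1 + s ^ 2) ^ η := Real.one_le_rpow (by nlinarith) hη.le
    have h2 : 0 ≤ |C| / η := by positivity
    have h3 := norm_nonneg (f 0)
    nlinarith

end Euler

end SchwartzMap

namespace CPT

open SchwartzMap

/-! ### Zeros of almost homogeneous distributions -/

section Zero

variable {ι : Type} [Fintype ι]

/-- A tempered distribution as a real-linear functional on test functions. -/
noncomputable def toRealCLM {V : Type} [NormedAddCommGroup V] [NormedSpace ℝ V] (t : 𝓢'(V, ℂ)) :
    𝓢(V, ℂ) →L[ℝ] ℂ :=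
  ContinuousLinearMap.restrictScalars ℝ (show 𝓢(V, ℂ) →L[ℂ] ℂ from t)

theorem toRealCLM_apply {V : Type} [NormedAddCommGroup V] [NormedSpace ℝ V] (t : 𝓢'(V, ℂ))
    (g : 𝓢(V, ℂ)) : toRealCLM t g = t g := rfl

theorem lineDerivOp_rescale {ε : ℝ} (hε : ε ≠ 0) (v : EuclideanSpace ℝ ι)
    (g : 𝓢(EuclideanSpace ℝ ι, ℂ)) :
    ∂_{v} (rescale ε g) = (ε⁻¹ : ℂ) • rescale ε (∂_{v} g) := by
  ext q
  have h1 : HasFDerivAt (rescale ε g) (((ε⁻¹ ^ Fintype.card ι : ℝ) : ℂ) •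
      (fderiv ℝ g (ε⁻¹ • q) ∘L (ε⁻¹ • ContinuousLinearMap.id ℝ _))) q := by
    have h2 : (rescale ε g : EuclideanSpace ℝ ι → ℂ) =
        fun q => ((ε⁻¹ ^ Fintype.card ι : ℝ) : ℂ) • g (ε⁻¹ • q) :=
      funext fun q => rescale_apply hε g q
    rw [h2]
    have h3 : HasFDerivAt (fun q => g (ε⁻¹ • q))
        (fderiv ℝ g (ε⁻¹ • q) ∘L (ε⁻¹ • ContinuousLinearMap.id ℝ _)) q :=
      (g.hasFDerivAt (ε⁻¹ • q)).comp q
        ((ε⁻¹ • ContinuousLinearMap.id ℝ (EuclideanSpace ℝ ι)).hasFDerivAt)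
    exact h3.const_smul ((ε⁻¹ ^ Fintype.card ι : ℝ) : ℂ)
  rw [lineDerivOp_apply_eq_fderiv, h1.fderiv]
  simp [rescale_apply hε, lineDerivOp_apply_eq_fderiv]
  ring

theorem exists_iterate_lineDerivOp_rescale (t : 𝓢'(EuclideanSpace ℝ ι, ℂ))
    (v : EuclideanSpace ℝ ι) (n : ℕ) (g : 𝓢(EuclideanSpace ℝ ι, ℂ)) :
    ∃ g', ∀ ε : ℝ, ε ≠ 0 →
      ((fun r => ∂_{v} r)^[n] t) (rescale ε g) = (ε⁻¹ : ℂ) ^ n * t (rescale ε g') := by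
  induction n generalizing t with
  | zero => exact ⟨g, fun ε _ => by simp⟩
  | succ n ih =>
    obtain ⟨g', hg'⟩ := ih (∂_{v} t)
    refine ⟨-∂_{v} g', fun ε hε => ?_⟩
    have hneg : rescale ε (-∂_{v} g') = -rescale ε (∂_{v} g') := by
      ext q
      simp [rescale_apply hε]
    rw [Function.iterate_succ_apply, hg' ε hε, TemperedDistribution.lineDerivOp_apply_apply,
      lineDerivOp_rescale hε, hneg, ← smul_neg, map_smul, smul_eq_mul]
    ring

variable [DecidableEq ι]

/-- Each derivative of `t`, transposed to the rescaled test function, yields a factor `ε⁻¹`; the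
remaining test function `g'` does not depend on `ε`. -/
theorem exists_multiDeriv_rescale (γ : ι → ℕ) (t : 𝓢'(EuclideanSpace ℝ ι, ℂ))
    (g : 𝓢(EuclideanSpace ℝ ι, ℂ)) :
    ∃ g', ∀ ε : ℝ, ε ≠ 0 →
      multiDeriv γ t (rescale ε g) = (ε⁻¹ : ℂ) ^ (∑ j, γ j) * t (rescale ε g') := by
  have h : ∀ (l : List ι) (g : 𝓢(EuclideanSpace ℝ ι, ℂ)), ∃ g', ∀ ε : ℝ, ε ≠ 0 →
      (l.foldr (fun j s => (fun r => ∂_{EuclideanSpace.single j (1 : ℝ)} r)^[γ j] s) t)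
        (rescale ε g) = (ε⁻¹ : ℂ) ^ (l.map γ).sum * t (rescale ε g') := by
    intro l
    induction l with
    | nil => exact fun g => ⟨g, fun ε _ => by simp⟩
    | cons j l ih =>
      intro g
      obtain ⟨g₁, h₁⟩ := exists_iterate_lineDerivOp_rescale
        (l.foldr (fun j s => (fun r => ∂_{EuclideanSpace.single j (1 : ℝ)} r)^[γ j] s) t)
        (EuclideanSpace.single j (1 : ℝ)) (γ j) g
      obtain ⟨g₂, h₂⟩ := ih g₁
      refine ⟨g₂, fun ε hε => ?_⟩
      rw [List.foldr_cons, h₁ ε hε, h₂ ε hε, List.map_cons, List.sum_cons, pow_add, mul_assoc]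
  obtain ⟨g', hg'⟩ := h Finset.univ.toList g
  refine ⟨g', fun ε hε => ?_⟩
  rw [multiDeriv, hg' ε hε, Finset.sum_map_toList]

/-- Up to logarithms, `τ` is homogeneous of degree `ω`, and its derivatives of order `|γ| < ω` are
homogeneous of the positive degree `ω - |γ|`. -/
theorem hasZeroOfOrder_of_iterate_eulerAdd (τ : 𝓢'(EuclideanSpace ℝ ι, ℂ)) (ω : ℚ) (m : ℕ)
    (h : ∀ g, τ ((eulerAdd ((Fintype.card ι : ℝ) + (ω : ℝ)))^[m] g) = 0) : HasZeroOfOrder τ ω := by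
  intro γ hγ g _
  set N := Fintype.card ι with hN
  set c : ℝ := (N : ℝ) + (ω : ℝ) with hc
  have hγ' : ((∑ j, γ j : ℕ) : ℝ) < (ω : ℝ) := by exact_mod_cast hγ
  set k := ∑ j, γ j with hk
  obtain ⟨g', hg'⟩ := exists_multiDeriv_rescale γ τ g
  -- Half of the available exponent `ω - |γ|` is spent on the logarithms.
  set η : ℝ := ((ω : ℝ) - k) / 2 with hη
  have hηpos : 0 < η := by rw [hη]; linarith
  obtain ⟨C, hC⟩ := exists_norm_clm_dilate_le (toRealCLM τ) c hηpos m g' (fun a => by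
    rw [← iterate_eulerAdd_dilate]
    exact h _)
  have hbound : ∀ᶠ ε : ℝ in 𝓝[>] 0,
      ‖multiDeriv γ τ (rescale ε g)‖ ≤ C * ε ^ η := by
    filter_upwards [Ioc_mem_nhdsGT (zero_lt_one' ℝ)] with ε hε
    have hε0 : 0 < ε := hε.1
    have hle : 1 ≤ ε⁻¹ := (one_le_inv₀ hε0).mpr hε.2
    -- The parameter at which the dilation factor `1 + s²` equals `ε⁻¹`.
    set s := Real.sqrt (ε⁻¹ - 1) with hs
    have hs2 : 1 + s ^ 2 = ε⁻¹ := by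
      rw [hs, Real.sq_sqrt (by linarith)]
      ring
    have h1 := hC s (Real.sqrt_nonneg _)
    have h2 : rescale ε g' = ((ε⁻¹ ^ N : ℝ) : ℂ) • dilate (oneAddSq s) g' := by
      ext q
      rw [rescale_apply hε0.ne', smul_apply, dilate_apply, smul_eq_mul]
      simp only [oneAddSq, Units.val_mk0, hs2, hN]
    rw [hs2, toRealCLM_apply, norm_smul, Real.norm_of_nonneg (by positivity)] at h1
    rw [hg' ε hε0.ne', h2, map_smul, smul_eq_mul, norm_mul, norm_mul, norm_pow, norm_inv,
      Complex.norm_real, Complex.norm_real, Real.norm_of_nonneg hε0.le,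
      Real.norm_of_nonneg (by positivity)]
    set A := ‖τ (dilate (oneAddSq s) g')‖
    have h3 : A ≤ C * (ε⁻¹ ^ η * ε ^ c) := by
      rw [Real.inv_rpow hε0.le, Real.inv_rpow hε0.le, inv_mul_le_iff₀ (by positivity)] at h1
      rw [Real.inv_rpow hε0.le]
      linarith
    calc ε⁻¹ ^ k * (ε⁻¹ ^ N * A) ≤ ε⁻¹ ^ k * (ε⁻¹ ^ N * (C * (ε⁻¹ ^ η * ε ^ c))) := by gcongr
      _ = C * (ε ^ (-(k : ℝ)) * ε ^ (-(N : ℝ)) * ε ^ (-η) * ε ^ c) := by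
        rw [Real.rpow_neg hε0.le, Real.rpow_neg hε0.le, Real.rpow_neg hε0.le, Real.rpow_natCast,
          Real.rpow_natCast, Real.inv_rpow hε0.le, inv_pow, inv_pow]
        ring
      _ = C * ε ^ η := by
        rw [← Real.rpow_add hε0, ← Real.rpow_add hε0, ← Real.rpow_add hε0]
        congr 2
        rw [hη, hc]
        ring
  have hlim : Tendsto (fun ε : ℝ => C * ε ^ η) (𝓝[>] 0) (𝓝 0) := by
    have : Tendsto (fun ε : ℝ => ε ^ η) (𝓝 0) (𝓝 0) := by
      have := (Real.continuousAt_rpow_const 0 η (Or.inr hηpos.le)).tendsto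
      rwa [Real.zero_rpow hηpos.ne'] at this
    simpa using (this.mono_left nhdsWithin_le_nhds).const_mul C
  have h0 := (squeeze_zero_norm' hbound hlim).div_const ((2 * Real.pi : ℂ) ^ N)
  simpa using h0

end Zero

end CPT

namespace CPT

namespace FieldContent

variable {M : FieldContent}

/-! ### Derivatives of homogeneous polynomials -/

theorem Gen.deriv_toField_mul (h g : M.Gen) (y : M.SymField) :
    ∃ a b : ℂ, (a ≠ 0 → g = h) ∧
      h.deriv (g.toField * y) = a • y + b • (g.toField * h.deriv y) := by
  classical
  by_cases hh : Even h.fermion <;> by_cases hg : Even g.fermion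
  · refine ⟨if g = h then 1 else 0, 1, by simp, ?_⟩
    induction y using TensorProduct.induction_on with
    | zero => simp
    | add y z hy hz => rw [mul_add, map_add, hy, hz, map_add, mul_add]; simp only [smul_add]; abel
    | tmul p e =>
      simp only [Gen.toField, Gen.deriv, hh, hg, dif_pos, Algebra.TensorProduct.tmul_mul_tmul,
        TensorProduct.map_tmul, one_mul, LinearMap.id_coe, id_eq, Derivation.coeFn_coe,
        Derivation.leibniz, MvPolynomial.pderiv_X, smul_eq_mul, TensorProduct.add_tmul]
      by_cases hgh : g = h
      · subst hgh
        simp [add_comm]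
      · have : (⟨g, hg⟩ : M.EvenGen) ≠ ⟨h, hh⟩ := fun e => hgh (congrArg Subtype.val e)
        simp [hgh, this]
  · refine ⟨0, 1, by simp, ?_⟩
    induction y using TensorProduct.induction_on with
    | zero => simp
    | add y z hy hz => rw [mul_add, map_add, hy, hz, map_add, mul_add]; simp only [smul_add]; abel
    | tmul p e => simp [Gen.toField, Gen.deriv, hh, hg]
  · refine ⟨0, 1, by simp, ?_⟩
    induction y using TensorProduct.induction_on with
    | zero => simp
    | add y z hy hz => rw [mul_add, map_add, hy, hz, map_add, mul_add]; simp only [smul_add]; abel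
    | tmul p e => simp [Gen.toField, Gen.deriv, hh, hg]
  · refine ⟨if g = h then 1 else 0, -1, by simp, ?_⟩
    induction y using TensorProduct.induction_on with
    | zero => simp
    | add y z hy hz => rw [mul_add, map_add, hy, hz, map_add, mul_add]; simp only [smul_add]; abel
    | tmul p e =>
      have key := CliffordAlgebra.contractLeft_ι_mul
        (Q := (0 : QuadraticForm ℂ (M.OddGen →₀ ℂ)))
        (Finsupp.lapply (⟨h, hh⟩ : M.OddGen) : (M.OddGen →₀ ℂ) →ₗ[ℂ] ℂ) (Finsupp.single ⟨g, hg⟩ 1) e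
      simp only [Gen.toField, Gen.deriv, hh, hg, dif_neg, not_false_eq_true,
        Algebra.TensorProduct.tmul_mul_tmul, TensorProduct.map_tmul, one_mul, LinearMap.id_coe,
        id_eq]
      erw [key]
      rw [TensorProduct.tmul_sub, TensorProduct.tmul_smul, sub_eq_add_neg]
      refine congrArg₂ (· + ·) ?_ (neg_one_smul ℂ _).symm
      simp [Finsupp.single_apply]

theorem Gen.deriv_algebraMap_one (h : M.Gen) : h.deriv (1 : M.SymField) = 0 := by
  classical
  by_cases hh : Even h.fermion <;>
    simp [Gen.deriv, hh, Algebra.TensorProduct.one_def]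

/-- The derivative of a monomial is a combination of monomials in which one factor is removed. -/
theorem Gen.deriv_prod_mem (h : M.Gen) (l : List M.Gen) :
    h.deriv (l.map Gen.toField).prod ∈ homogeneous M ((l.map Gen.fermion).sum - h.fermion)
      ((l.map Gen.charge).sum - h.charge) ((l.map Gen.dim).sum - h.dim) := by
  induction l with
  | nil => simp [Gen.deriv_algebraMap_one]
  | cons g l ih =>
    obtain ⟨a, b, hab, he⟩ := Gen.deriv_toField_mul h g (l.map Gen.toField).prod
    have hprod : ((g :: l).map Gen.toField).prod = g.toField * (l.map Gen.toField).prod := by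
      rw [List.map_cons, List.prod_cons]
    rw [hprod, he]
    refine Submodule.add_mem _ ?_ (Submodule.smul_mem _ b ?_)
    · by_cases ha : a = 0
      · simp [ha]
      · obtain rfl := hab ha
        refine Submodule.smul_mem _ a (Submodule.subset_span ⟨l, ?_, ?_, ?_, rfl⟩) <;> simp
    · generalize h.deriv (l.map Gen.toField).prod = y at ih
      induction ih using Submodule.span_induction with
      | mem y hy =>
        obtain ⟨l', h1, h2, h3, rfl⟩ := hy
        refine Submodule.subset_span ⟨g :: l', ?_, ?_, ?_, by simp⟩
        · simp only [List.map_cons, List.sum_cons, h1]; ring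
        · simp only [List.map_cons, List.sum_cons, h2]; ring
        · simp only [List.map_cons, List.sum_cons, h3]; ring
      | zero => simp
      | add y z _ _ hy hz => rw [mul_add]; exact Submodule.add_mem _ hy hz
      | smul c y _ hy => rw [mul_smul_comm]; exact Submodule.smul_mem _ c hy

theorem Gen.deriv_mem (h : M.Gen) {f q : ℤ} {d : ℚ} {B : M.SymField}
    (hB : B ∈ homogeneous M f q d) :
    h.deriv B ∈ homogeneous M (f - h.fermion) (q - h.charge) (d - h.dim) := by
  induction hB using Submodule.span_induction with
  | mem B hB =>
    obtain ⟨l, rfl, rfl, rfl, rfl⟩ := hB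
    exact Gen.deriv_prod_mem h l
  | zero => simp
  | add y z _ _ hy hz => rw [map_add]; exact Submodule.add_mem _ hy hz
  | smul c y _ hy => rw [map_smul]; exact Submodule.smul_mem _ c hy

theorem Index.sum_map_dim_toList (u : M.Index) : (u.toList.map Gen.dim).sum = u.dim := by
  have h : ∀ u : M.Index,
      ((Finsupp.toMultiset u).map Gen.dim).sum = u.sum fun g k => k * g.dim := by
    intro u
    induction u using Finsupp.induction_linear with
    | zero => simp
    | add u v hu hv =>
      rw [Finsupp.toMultiset_add, Multiset.map_add, Multiset.sum_add, hu, hv,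
        Finsupp.sum_add_index' (by simp) (fun _ _ _ => by push_cast; ring)]
    | single g k => simp [Finsupp.toMultiset_single, Multiset.map_nsmul, Multiset.sum_nsmul]
  rw [Index.toList, ← Multiset.sum_coe, ← Multiset.map_coe, Multiset.sort_eq]
  exact h u

theorem exists_subPoly_mem {f q : ℤ} {d : ℚ} {B : M.SymField} (hB : B ∈ homogeneous M f q d)
    (u : M.Index) : ∃ f' q', subPoly B u ∈ homogeneous M f' q' (d - u.dim) := by
  have h : ∀ (l : List M.Gen) (f q : ℤ) (d : ℚ) (B : M.SymField), B ∈ homogeneous M f q d →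
      ∃ f' q', l.foldl (fun C g => g.deriv C) B ∈
        homogeneous M f' q' (d - (l.map Gen.dim).sum) := by
    intro l
    induction l with
    | nil => exact fun f q d B hB => ⟨f, q, by simpa using hB⟩
    | cons g l ih =>
      intro f q d B hB
      obtain ⟨f', q', h'⟩ := ih _ _ _ _ (Gen.deriv_mem g hB)
      refine ⟨f', q', ?_⟩
      rw [List.map_cons, List.sum_cons, ← sub_sub]
      exact h'
  rw [← Index.sum_map_dim_toList]
  exact h u.toList f q d B hB

theorem homogeneous_le_masslessHomogeneous (hM : ∀ s, M.mass s = 0) (f q : ℤ) (d : ℚ) :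
    homogeneous M f q d ≤ masslessHomogeneous M f q d :=
  Submodule.span_mono fun _ ⟨l, h⟩ => ⟨l, fun g _ => hM g.field.1, h⟩

end FieldContent

end CPT

namespace CPT

open SchwartzMap FieldContent

/-! ### The Euler operator and the Fourier transform -/

section EulerFourier

variable {ι : Type} [Fintype ι]

theorem hasTemperateGrowth_coord (j : ι) :
    (fun x : EuclideanSpace ℝ ι => (x j : ℂ)).HasTemperateGrowth :=
  (Complex.ofRealCLM ∘L (EuclideanSpace.proj j : EuclideanSpace ℝ ι →L[ℝ] ℝ)).hasTemperateGrowth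

variable [DecidableEq ι]

theorem fderiv_apply_self_eq_sum (g : 𝓢(EuclideanSpace ℝ ι, ℂ)) (x : EuclideanSpace ℝ ι) :
    fderiv ℝ g x x = ∑ j, (x j : ℂ) * (∂_{EuclideanSpace.single j (1 : ℝ)} g) x := by
  have hx : x = ∑ j, x j • EuclideanSpace.single j (1 : ℝ) := by
    ext k
    simp [Pi.single_apply]
  conv_lhs => enter [2]; rw [hx]
  rw [map_sum]
  refine Finset.sum_congr rfl fun j _ => ?_
  rw [(fderiv ℝ g x).map_smul, lineDerivOp_apply_eq_fderiv]
  simp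

theorem lineDerivOp_smulLeftCLM_coord (j : ι) (g : 𝓢(EuclideanSpace ℝ ι, ℂ)) :
    ∂_{EuclideanSpace.single j (1 : ℝ)} (smulLeftCLM ℂ (fun x => (x j : ℂ)) g) =
      g + smulLeftCLM ℂ (fun x => (x j : ℂ)) (∂_{EuclideanSpace.single j (1 : ℝ)} g) := by
  ext x
  have h1 : HasFDerivAt (fun x : EuclideanSpace ℝ ι => (x j : ℂ))
      (Complex.ofRealCLM ∘L (EuclideanSpace.proj j : EuclideanSpace ℝ ι →L[ℝ] ℝ)) x :=
    (Complex.ofRealCLM ∘L (EuclideanSpace.proj j : EuclideanSpace ℝ ι →L[ℝ] ℝ)).hasFDerivAt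
  have h2 : (smulLeftCLM ℂ (fun x => (x j : ℂ)) g : EuclideanSpace ℝ ι → ℂ) =
      fun x => (x j : ℂ) * g x :=
    funext fun x => smulLeftCLM_apply_apply (hasTemperateGrowth_coord j) g x
  rw [lineDerivOp_apply_eq_fderiv, h2,
    fderiv_fun_mul h1.differentiableAt g.differentiableAt, h1.fderiv, add_apply, add_apply,
    smulLeftCLM_apply_apply (hasTemperateGrowth_coord j), lineDerivOp_apply_eq_fderiv]
  simp [add_comm]

theorem eulerAdd_card_sub (D : ℝ) (g : 𝓢(EuclideanSpace ℝ ι, ℂ)) :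
    eulerAdd ((Fintype.card ι : ℝ) - D) g =
      (∑ j, ∂_{EuclideanSpace.single j (1 : ℝ)} (smulLeftCLM ℂ (fun x => (x j : ℂ)) g)) -
        (D : ℂ) • g := by
  ext x
  rw [eulerAdd_apply, fderiv_apply_self_eq_sum, sub_apply, sum_apply]
  simp only [lineDerivOp_smulLeftCLM_coord, add_apply,
    smulLeftCLM_apply_apply (hasTemperateGrowth_coord _), Finset.sum_add_distrib, smul_apply,
    smul_eq_mul, Finset.sum_const, Finset.card_univ, nsmul_eq_mul]
  push_cast
  ring

/-- Up to the sign, `eulerShift D` is the transpose of the Euler operator shifted by `N - D`. -/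
theorem eulerShift_apply (D : ℝ) (t : 𝓢'(EuclideanSpace ℝ ι, ℂ)) (g : 𝓢(EuclideanSpace ℝ ι, ℂ)) :
    eulerShift D t g = -t (eulerAdd ((Fintype.card ι : ℝ) - D) g) := by
  rw [eulerAdd_card_sub, map_sub, map_sum, map_smul, eulerShift, add_apply, sum_apply, smul_apply]
  simp only [TemperedDistribution.smulLeftCLM_apply_apply,
    TemperedDistribution.lineDerivOp_apply_apply, map_neg, Finset.sum_neg_distrib]
  ring

theorem eulerAdd_fourier (g : 𝓢(EuclideanSpace ℝ ι, ℂ)) (c : ℝ) :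
    eulerAdd c (𝓕 g) = -𝓕 (eulerAdd ((Fintype.card ι : ℝ) - c) g) := by
  have hin : ∀ j : ι, (fun x : EuclideanSpace ℝ ι =>
      inner ℝ x (EuclideanSpace.single j (1 : ℝ))).HasTemperateGrowth := fun j =>
    ((innerSL ℝ).flip (EuclideanSpace.single j (1 : ℝ))).hasTemperateGrowth
  have hsm : ∀ (j : ι) (f : 𝓢(EuclideanSpace ℝ ι, ℂ)),
      smulLeftCLM ℂ (inner ℝ · (EuclideanSpace.single j (1 : ℝ))) f =
        smulLeftCLM ℂ (fun x : EuclideanSpace ℝ ι => (x j : ℂ)) f := by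
    intro j f
    ext x
    rw [smulLeftCLM_apply_apply (hin j), smulLeftCLM_apply_apply (hasTemperateGrowth_coord j),
      EuclideanSpace.inner_single_right]
    simp
  have key : ∀ j : ι, smulLeftCLM ℂ (fun x : EuclideanSpace ℝ ι => (x j : ℂ))
      (∂_{EuclideanSpace.single j (1 : ℝ)} (𝓕 g)) = -𝓕 (∂_{EuclideanSpace.single j (1 : ℝ)}
        (smulLeftCLM ℂ (fun x : EuclideanSpace ℝ ι => (x j : ℂ)) g)) := by
    intro j
    rw [lineDerivOp_fourier_eq, fourier_lineDerivOp_eq, hsm, hsm, FourierTransform.fourier_smul,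
      map_smul, neg_smul]
  have h1 : eulerAdd c (𝓕 g) = (∑ j, smulLeftCLM ℂ (fun x : EuclideanSpace ℝ ι => (x j : ℂ))
      (∂_{EuclideanSpace.single j (1 : ℝ)} (𝓕 g))) + (c : ℂ) • 𝓕 g := by
    ext x
    rw [eulerAdd_apply, fderiv_apply_self_eq_sum, add_apply, sum_apply]
    simp only [smulLeftCLM_apply_apply (hasTemperateGrowth_coord _), smul_apply, smul_eq_mul]
  have hF : ∀ f : 𝓢(EuclideanSpace ℝ ι, ℂ), 𝓕 f = FourierTransform.fourierCLM ℂ _ f :=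
    fun f => rfl
  rw [h1, eulerAdd_card_sub]
  simp only [key]
  rw [hF (_ - _), map_sub, map_sum, map_smul]
  simp only [← hF]
  rw [Finset.sum_neg_distrib]
  abel

end EulerFourier

theorem eulerAdd_fourierTest (n : ℕ) (c : ℝ) (g : 𝓢(Config n, ℂ)) :
    eulerAdd c (fourierTest n g) =
      -fourierTest n (eulerAdd ((Fintype.card (Fin n × Fin 4) : ℝ) - c) g) := by
  ext x
  have h := eulerAdd_apply_of_comp_linear (minkScale n : Config n →L[ℝ] Config n)
    (g := 𝓕 g) (g' := fourierTest n g) (fun x => rfl) c x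
  rw [h, eulerAdd_fourier]
  rfl

/-- A power of `eulerShift D` acting on `t` is the transpose of the same power of the Euler operator
shifted by `D` acting on the test functions of the Fourier transform: the transposition and the
Fourier transform replace `D` by `N - D` once each. -/
theorem iterate_eulerShift_fourierTest {n : ℕ} (D : ℝ) (m : ℕ) (t : 𝓢'(Config n, ℂ))
    (g : 𝓢(Config n, ℂ)) :
    (eulerShift D)^[m] t (fourierTest n g) = fourierDist t ((eulerAdd D)^[m] g) := by
  induction m generalizing t with
  | zero => rfl
  | succ m ih =>
    rw [Function.iterate_succ_apply, ih, fourierDist_apply, eulerShift_apply,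
      eulerAdd_fourierTest, map_neg, neg_neg, sub_sub_cancel, ← fourierDist_apply,
      ← Function.iterate_succ_apply' (eulerAdd D)]

/-! ### Translation invariance and momentum conservation -/

theorem U_vacuum (M : FieldContent) (a : Fin 4 → ℝ) : U M a (vacuum M) = vacuum M := by
  apply Subtype.ext
  funext l
  change Complex.exp _ * vacuumWave M l = vacuumWave M l
  cases l <;> simp [vacuumWave]

theorem TimeOrdered.vev_compSubConstCLM {M : FieldContent} (T : TimeOrdered M) (n : ℕ)
    (B : Fin n → M.SymField) (a : Fin 4 → ℝ) (g : 𝓢(Config n, ℂ)) :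
    T.vev n B (compSubConstCLM ℂ (diag n a) g) = T.vev n B g := by
  have h := LinearMap.congr_fun (T.covariance n B a g) (vacuum M)
  rw [LinearMap.comp_apply, LinearMap.comp_apply, U_vacuum] at h
  rw [TimeOrdered.vev_apply, TimeOrdered.vev_apply, ← h]
  change Complex.exp _ * (T.T n B g (vacuum M) : M.Wave) [] = _
  simp

theorem apply_lineDerivOp_diag_eq_zero {n : ℕ} {t : 𝓢'(Config n, ℂ)}
    (ht : ∀ (a : Fin 4 → ℝ) (g : 𝓢(Config n, ℂ)), t (compSubConstCLM ℂ (diag n a) g) = t g)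
    (a : Fin 4 → ℝ) (g : 𝓢(Config n, ℂ)) : t (∂_{diag n a} g) = 0 := by
  have h := hasDerivAt_clm_translate (toRealCLM t) g (diag n a) 0
  have h1 : (fun s : ℝ => toRealCLM t (compSubConstCLM ℝ (-(s • diag n a)) g)) =
      fun _ => t g := by
    funext s
    rw [← ht (-(s • a)) g, toRealCLM_apply]
    congr 1
  rw [h1] at h
  have h2 := h.unique (hasDerivAt_const (0 : ℝ) (t g))
  simpa [compSubConstCLM_zero, toRealCLM_apply] using h2

/-- The sum `q_1 + ⋯ + q_n` of the momenta. -/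
noncomputable def totalMom (n : ℕ) : Config n →L[ℝ] EuclideanSpace ℝ (Fin 4) :=
  LinearMap.toContinuousLinearMap
    { toFun := fun q => WithLp.toLp 2 fun μ => ∑ j, q (j, μ)
      map_add' := fun q q' => by
        ext μ
        simp [Finset.sum_add_distrib]
      map_smul' := fun c q => by
        ext μ
        simp [Finset.mul_sum] }

theorem totalMom_apply (n : ℕ) (q : Config n) (μ : Fin 4) : totalMom n q μ = ∑ j, q (j, μ) := rfl

/-- The Fourier transform of a translation invariant distribution is annihilated by the components
of the total momentum. -/
theorem fourierDist_totalMom_mul_eq_zero {n : ℕ} {t : 𝓢'(Config n, ℂ)}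
    (ht : ∀ (a : Fin 4 → ℝ) (g : 𝓢(Config n, ℂ)), t (compSubConstCLM ℂ (diag n a) g) = t g)
    (μ : Fin 4) (g : 𝓢(Config n, ℂ)) :
    fourierDist t (smulLeftCLM ℂ (fun q => (totalMom n q μ : ℂ)) g) = 0 := by
  -- `-2πη` undoes the rescaling `-(2π)⁻¹η` in `minkScale`.
  set a : Fin 4 → ℝ := Pi.single μ (-(2 * Real.pi) * metricSign μ) with ha
  have hms : metricSign μ * metricSign μ = 1 := by
    rw [metricSign]
    split_ifs <;> norm_num
  have hdiag : ∀ (jν : Fin n × Fin 4), minkScale n (diag n a) jν = if jν.2 = μ then 1 else 0 := by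
    rintro ⟨j, ν⟩
    rw [minkScale_apply]
    change -(2 * Real.pi)⁻¹ * (metricSign ν * a ν) = _
    by_cases hν : ν = μ
    · subst hν
      rw [ha, Pi.single_eq_same, if_pos rfl]
      calc _ = ((2 * Real.pi)⁻¹ * (2 * Real.pi)) * (metricSign ν * metricSign ν) := by ring
        _ = 1 := by rw [hms, inv_mul_cancel₀ Real.two_pi_pos.ne', one_mul]
    · rw [ha, Pi.single_eq_of_ne hν, if_neg hν]
      ring
  have hinner : ∀ q : Config n, inner ℝ q (minkScale n (diag n a)) = totalMom n q μ := by
    intro q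
    rw [PiLp.inner_apply, totalMom_apply, Fintype.sum_prod_type]
    simp [hdiag]
  have hin : (fun q : Config n => inner ℝ q (minkScale n (diag n a))).HasTemperateGrowth :=
    ((innerSL ℝ).flip (minkScale n (diag n a))).hasTemperateGrowth
  have hQ : (fun q : Config n => (totalMom n q μ : ℂ)).HasTemperateGrowth :=
    (Complex.ofRealCLM ∘L (EuclideanSpace.proj μ : EuclideanSpace ℝ (Fin 4) →L[ℝ] ℝ) ∘L
      totalMom n).hasTemperateGrowth
  have hsm : smulLeftCLM ℂ (inner ℝ · (minkScale n (diag n a))) g =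
      smulLeftCLM ℂ (fun q => (totalMom n q μ : ℂ)) g := by
    ext q
    rw [smulLeftCLM_apply_apply hin, smulLeftCLM_apply_apply hQ, hinner]
    simp
  have h1 : ∂_{diag n a} (fourierTest n g) =
      (-(2 * Real.pi * Complex.I)) •
        fourierTest n (smulLeftCLM ℂ (fun q => (totalMom n q μ : ℂ)) g) := by
    have h2 : ∀ f, fourierTest n f = compCLMOfContinuousLinearEquiv ℂ (minkScale n) (𝓕 f) :=
      fun f => rfl
    rw [h2, lineDerivOp_compCLMOfContinuousLinearEquiv, lineDerivOp_fourier_eq, hsm, ← h2, map_smul]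
  have h3 := apply_lineDerivOp_diag_eq_zero ht a (fourierTest n g)
  rw [h1, map_smul, smul_eq_mul] at h3
  exact (mul_eq_zero.mp h3).resolve_left (neg_ne_zero.mpr Complex.two_pi_I_ne_zero)

/-- The first `n` of `n + 1` momenta. -/
noncomputable def firstMoms (n : ℕ) : Config (n + 1) →L[ℝ] Config n :=
  LinearMap.toContinuousLinearMap
    { toFun := fun q => WithLp.toLp 2 fun jμ => q (jμ.1.castSucc, jμ.2)
      map_add' := fun q q' => by
        ext jμ
        simp
      map_smul' := fun c q => by
        ext jμ
        simp }

theorem firstMoms_apply (n : ℕ) (q : Config (n + 1)) (j : Fin n) (μ : Fin 4) :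
    firstMoms n q (j, μ) = q (j.castSucc, μ) := rfl

/-- The configuration `(0, …, 0, w)`. -/
noncomputable def lastMom (n : ℕ) : EuclideanSpace ℝ (Fin 4) →L[ℝ] Config (n + 1) :=
  LinearMap.toContinuousLinearMap
    { toFun := fun w => WithLp.toLp 2 fun jμ => if jμ.1 = Fin.last n then w jμ.2 else 0
      map_add' := fun w w' => by
        ext jμ
        by_cases h : jμ.1 = Fin.last n <;> simp [h]
      map_smul' := fun c w => by
        ext jμ
        by_cases h : jμ.1 = Fin.last n <;> simp [h] }

theorem lastMom_apply (n : ℕ) (w : EuclideanSpace ℝ (Fin 4)) (j : Fin (n + 1)) (μ : Fin 4) :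
    lastMom n w (j, μ) = if j = Fin.last n then w μ else 0 := rfl

theorem conserve_firstMoms_add_lastMom (n : ℕ) (q : Config (n + 1)) :
    conserve n (firstMoms n q) + lastMom n (totalMom (n + 1) q) = q := by
  ext ⟨j, μ⟩
  rw [PiLp.add_apply, lastMom_apply]
  refine Fin.lastCases ?_ (fun j => ?_) j
  · rw [conserve_last, if_pos rfl, totalMom_apply, Fin.sum_univ_castSucc]
    simp [firstMoms_apply]
  · rw [conserve_castSucc, if_neg (Fin.castSucc_lt_last j).ne, firstMoms_apply, add_zero]

theorem firstMoms_conserve (n : ℕ) (q : Config n) : firstMoms n (conserve n q) = q := by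
  ext ⟨j, μ⟩
  rw [firstMoms_apply, conserve_castSucc]

theorem totalMom_conserve (n : ℕ) (q : Config n) : totalMom (n + 1) (conserve n q) = 0 := by
  ext μ
  rw [totalMom_apply, Fin.sum_univ_castSucc, conserve_last]
  simp [conserve_castSucc]

/-- The test function `h(q_1, …, q_n) χ(q_1 + ⋯ + q_{n+1})`. -/
noncomputable def extendTest (n : ℕ) (χ : 𝓢(EuclideanSpace ℝ (Fin 4), ℂ)) :
    𝓢(Config n, ℂ) →L[ℂ] 𝓢(Config (n + 1), ℂ) :=
  compCLM ℂ ((firstMoms n).prod (totalMom (n + 1))).hasTemperateGrowth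
    ⟨1, ‖conserve n‖ + ‖lastMom n‖, fun q => by
      have h1 := (conserve n).le_opNorm (firstMoms n q)
      have h2 := (lastMom n).le_opNorm (totalMom (n + 1) q)
      have h3 : ‖q‖ ≤ ‖conserve n (firstMoms n q)‖ + ‖lastMom n (totalMom (n + 1) q)‖ := by
        conv_lhs => rw [← conserve_firstMoms_add_lastMom n q]
        exact norm_add_le _ _
      have h4 := norm_fst_le ((firstMoms n).prod (totalMom (n + 1)) q)
      have h5 := norm_snd_le ((firstMoms n).prod (totalMom (n + 1)) q)
      set r := ‖(firstMoms n).prod (totalMom (n + 1)) q‖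
      calc ‖q‖ ≤ ‖conserve n‖ * ‖firstMoms n q‖ + ‖lastMom n‖ * ‖totalMom (n + 1) q‖ := by
            linarith
        _ ≤ ‖conserve n‖ * (1 + r) + ‖lastMom n‖ * (1 + r) := by
          gcongr
          · exact h4.trans (by linarith)
          · exact h5.trans (by linarith)
        _ = _ := by ring⟩ ∘L tensorCLM χ

theorem extendTest_apply (n : ℕ) (χ : 𝓢(EuclideanSpace ℝ (Fin 4), ℂ)) (h : 𝓢(Config n, ℂ))
    (q : Config (n + 1)) : extendTest n χ h q = h (firstMoms n q) * χ (totalMom (n + 1) q) := rfl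

/-- Momentum conservation: the Fourier transform of a translation invariant distribution is of the
form `(2π)^4 δ(q_1 + ⋯ + q_{n+1}) τ(q_1, …, q_n)`, and `τ` inherits its scaling behaviour. -/
theorem exists_fourierDist_eq_deltaTimes {n : ℕ} {t : 𝓢'(Config (n + 1), ℂ)}
    (ht : ∀ (a : Fin 4 → ℝ) (g : 𝓢(Config (n + 1), ℂ)),
      t (compSubConstCLM ℂ (diag (n + 1) a) g) = t g) :
    ∃ τ : 𝓢'(Config n, ℂ), fourierDist t = (2 * Real.pi : ℂ) ^ 4 • deltaTimes τ ∧
      ∀ (c : ℝ) (m : ℕ), (∀ g, fourierDist t ((eulerAdd c)^[m] g) = 0) →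
        ∀ h, τ ((eulerAdd c)^[m] h) = 0 := by
  obtain ⟨χ, hχ⟩ := exists_eventually_eq_one (0 : EuclideanSpace ℝ (Fin 4))
  have hχ0 : χ 0 = 1 := hχ.self_of_nhds
  have hpi : ((2 * Real.pi : ℂ) ^ 4) ≠ 0 := by
    have := Real.pi_ne_zero
    exact pow_ne_zero _ (by exact_mod_cast mul_ne_zero two_ne_zero this)
  have key : ∀ (g : 𝓢(Config (n + 1), ℂ)) (h : 𝓢(Config n, ℂ)), (∀ q, h q = g (conserve n q)) →
      fourierDist t g = fourierDist t (extendTest n χ h) := fun g h hgh =>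
    clm_eq_of_coord_mul_eq_zero (conserve n ∘L firstMoms n) (totalMom (n + 1)) (lastMom n)
      (conserve_firstMoms_add_lastMom n) (toRealCLM (fourierDist t))
      (fourierDist_totalMom_mul_eq_zero ht) hχ0 (fun q => by
        rw [extendTest_apply, hgh]
        rfl)
  let τ : 𝓢'(Config n, ℂ) :=
    ((2 * Real.pi : ℂ) ^ 4)⁻¹ • PointwiseConvergenceCLM.precomp ℂ (extendTest n χ) (fourierDist t)
  have hτ : ∀ h, τ h = ((2 * Real.pi : ℂ) ^ 4)⁻¹ * fourierDist t (extendTest n χ h) := fun h => rfl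
  refine ⟨τ, ?_, fun c m hc h => ?_⟩
  · ext g
    rw [smul_apply, smul_eq_mul]
    change _ = _ * τ _
    rw [hτ, mul_inv_cancel_left₀ hpi]
    exact key g _ fun q => rfl
  · have h1 : ∀ q, h q = extendTest n χ h (conserve n q) := fun q => by
      rw [extendTest_apply, firstMoms_conserve, totalMom_conserve, hχ0, mul_one]
    rw [hτ, ← key ((eulerAdd c)^[m] (extendTest n χ h)) ((eulerAdd c)^[m] h)
      (iterate_eulerAdd_apply_of_comp_linear (conserve n) c m h1), hc, mul_zero]

end CPT

/-! ### The condition for the weak adiabatic limit -/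

theorem mainTheorem7 (M : CPT.FieldContent) (hmassless : ∀ s, M.mass s = 0)
    (T : CPT.TimeOrdered M) {r : ℕ} (L : Fin r → M.SymField)
    (hL : ∀ l, ∃ q : ℤ, L l ∈ CPT.FieldContent.homogeneous M 0 q 4)
    (hT : T.AlmostHomogeneousScaling) : T.WeakAdiabatic L := by
  intro n l u _
  have hmem : ∀ j, ∃ f' q', CPT.FieldContent.subPoly (L (l j)) (u j) ∈
      CPT.FieldContent.masslessHomogeneous M f' q' (4 - (u j).dim) := fun j => by
    obtain ⟨q, hq⟩ := hL (l j)
    obtain ⟨f', q', h⟩ := CPT.FieldContent.exists_subPoly_mem hq (u j)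
    exact ⟨f', q', CPT.FieldContent.homogeneous_le_masslessHomogeneous hmassless _ _ _ h⟩
  choose f' q' hmem using hmem
  obtain ⟨P, hP, -⟩ := hT (n + 1) (Nat.le_add_left 1 n) _ f' q' _ hmem
  obtain ⟨τ, hτ, hscale⟩ := CPT.exists_fourierDist_eq_deltaTimes
    (T.vev_compSubConstCLM (n + 1) fun j => CPT.FieldContent.subPoly (L (l j)) (u j))
  refine ⟨τ, hτ, CPT.hasZeroOfOrder_of_iterate_eulerAdd τ _ (P + 1) ?_⟩
  -- The degree `4(n + 1) - ∑ dim(A^{u_j})` equals `4n + ω`.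
  have hD : (Fintype.card (Fin n × Fin 4) : ℝ) + ((4 - ∑ j, (u j).dim : ℚ) : ℝ) =
      ((∑ j, (4 - (u j).dim) : ℚ) : ℝ) := by
    rw [Finset.sum_sub_distrib]
    simp
    ring
  rw [hD]
  refine hscale _ _ fun g => ?_
  rw [← CPT.iterate_eulerShift_fourierTest, hP]
  rfl
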